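/- Let $\mathbb K\in\{\mathbb R,\mathbb C,\mathbb H\}$ and let $\ell^2(\mathbb N,\mathbb K)$ be the $\mathbb K$-Hilbert space of square-summable sequences with standard orthonormal basis $(e_j)_{j\ge 1}$. Let $\mathrm U_\infty(\ell^2(\mathbb N,\mathbb K))$ be the group of all unitary (i.e. surjective $\mathbb K$-linear isometric) operators $g$ for which $g-\mathbf 1$ is compact, with the topology of the operator norm, and let $\mathrm U_\infty(\ell^2(\mathbb N,\mathbb K))_0$ be its identity component. For $n\in\mathbb N$ regard $\mathrm U(n,\mathbb K)$ as the subgroup of those unitary operators that fix every $e_j$ with $j>n$, let $\mathrm U(n,\mathbb K)_0$ be its identity component, and let $\mathrm U(\infty,\mathbb K)_0=\bigcup_{n}\mathrm U(n,\mathbb K)_0\subseteq \mathrm U_\infty(\ell^2(\mathbb N,\mathbb K))_0$, endowed with the direct limit topology (the finest topology for which all inclusions $\mathrm U(n,\mathbb K)_0\hookrightarrow\mathrm U(\infty,\mathbb K)_0$ are continuous). For $n\in\mathbb N$ put $$\mathrm U(\infty,\mathbb K)_{0,n}:=\{g\in \mathrm U(\infty,\mathbb K)_0 : g e_j=e_j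 \text{ for all } j\le n\}.$$ Let $(\pi,\mathcal V)$ be a continuous unitary representation of $\mathrm U(\infty,\mathbb K)_0$ on a complex Hilbert space $\mathcal V$, i.e. a homomorphism into the unitary group of $\mathcal V$ such that $g\mapsto \pi(g)v$ is continuous for every $v\in\mathcal V$ (equivalently, $g\mapsto\pi(g)v$ is continuous on each $\mathrm U(n,\mathbb K)_0$). Then $\pi$ is tame, meaning that $$\bigcup_{n}\{v\in\mathcal V : \pi(g)v=v \text{ for all } g\in \mathrm U(\infty,\mathbb K)_{0,n}\}$$ is dense in $\mathcal V$, if and only if there is a unitary representation $\rho$ of $\mathrm U_\infty(\ell^2(\mathbb N,\mathbb K))_0$ on $\mathcal V$ with $\rho|_{\mathrm U(\infty,\mathbb K)_0}=\pi$ such that $g\mapsto\rho(g)v$ is continuous for the operator norm topology for every $v\in\mathcal V$. -/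

import Mathlib

open scoped Quaternion Topology

noncomputable section

namespace TameRep

/-! ### The Hilbert space `ℓ²(ℕ, K)` and its unitary group

`K` is a normed real algebra; it is used for `K = ℝ, ℂ, ℍ`. Basis vectors are indexed from `0`,
so "the first `n` basis vectors" are `e 0, …, e (n - 1)`. -/

section Groups

variable (K : Type) [NormedRing K] [NormedAlgebra ℝ K]

/-- The `K`-Hilbert space `ℓ²(ℕ, K)` of square-summable sequences, `‖x‖² = ∑ ‖x j‖²`, with
coordinatewise multiplication by scalars of `K` from the left. -/
abbrev Hilb : Type := lp (fun _ : ℕ => K) 2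

/-- `ℓ²(ℕ, K)` as a real normed space (a shortcut to the existing instance). -/
instance : NormedSpace ℝ (Hilb K) := lp.instNormedSpace

/-- The standard orthonormal basis of `ℓ²(ℕ, K)`. -/
def e (j : ℕ) : Hilb K := lp.single 2 j (1 : K)

/-- The unitary group `U(ℓ²(ℕ, K))`: all surjective `K`-linear isometries. -/
abbrev UFull : Type := Hilb K ≃ₗᵢ[K] Hilb K

/-- A unitary operator as an element of the normed algebra of bounded real-linear operators. -/
def toOp : UFull K →* (Hilb K →L[ℝ] Hilb K) where
  toFun g := ((g.toContinuousLinearEquiv : Hilb K →L[K] Hilb K)).restrictScalars ℝ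
  map_one' := rfl
  map_mul' _ _ := rfl

variable {K} in
@[simp] theorem toOp_apply (g : UFull K) (x : Hilb K) : toOp K g x = g x := rfl

/-- The unitary group carries the topology of the operator norm, `(g, h) ↦ ‖g - h‖`. -/
instance : TopologicalSpace (UFull K) := TopologicalSpace.induced (toOp K) inferInstance

/-- `U_∞(ℓ²(ℕ, K))`: the unitary operators `g` for which `g - 1` is compact. -/
def UCompact : Subgroup (UFull K) where
  carrier := {g | IsCompactOperator (fun x => g x - x)}
  one_mem' := by
    have h : (fun x : Hilb K => (1 : UFull K) x - x) = 0 := by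
      funext x; exact sub_self x
    simpa only [Set.mem_ofPred_eq, h] using isCompactOperator_zero
  mul_mem' := by
    intro g h hg hh
    have h1 : IsCompactOperator (fun x : Hilb K => (g (h x) - h x) + (h x - x)) :=
      (IsCompactOperator.comp_clm (f := fun x : Hilb K => g x - x) hg (toOp K h)).add hh
    have h2 : (fun x : Hilb K => (g * h) x - x) = fun x => (g (h x) - h x) + (h x - x) := by
      funext x; simp
    simpa only [Set.mem_ofPred_eq, h2] using h1
  inv_mem' := by
    intro g hg
    have h1 : IsCompactOperator (fun x : Hilb K => -(g (g⁻¹ x) - g⁻¹ x)) :=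
      (IsCompactOperator.comp_clm (f := fun x : Hilb K => g x - x) hg (toOp K g⁻¹)).neg
    have h2 : (fun x : Hilb K => g⁻¹ x - x) = fun x => -(g (g⁻¹ x) - g⁻¹ x) := by
      funext x
      have : g (g⁻¹ x) = x := g.apply_symm_apply x
      rw [this]; abel
    simpa only [Set.mem_ofPred_eq, h2] using h1

/-- `U(n, K)`, realized on `ℓ²(ℕ, K)`: the unitary operators fixing all basis vectors except
possibly the first `n`, i.e. those of the form `diag(A, 1)` with `A` a unitary `n × n` matrix. -/
def UFin (n : ℕ) : Subgroup (UFull K) where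
  carrier := {g | ∀ j, n ≤ j → g (e K j) = e K j}
  one_mem' := fun _ _ => rfl
  mul_mem' := by
    intro g h hg hh j hj
    change g (h (e K j)) = e K j
    rw [hh j hj, hg j hj]
  inv_mem' := by
    intro g hg j hj
    change g.symm (e K j) = e K j
    rw [LinearIsometryEquiv.symm_apply_eq, hg j hj]

/-- The stabilizer in the full unitary group of the first `n` basis vectors. -/
def stab (n : ℕ) : Subgroup (UFull K) where
  carrier := {g | ∀ j, j < n → g (e K j) = e K j}
  one_mem' := fun _ _ => rfl
  mul_mem' := by
    intro g h hg hh j hj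
    change g (h (e K j)) = e K j
    rw [hh j hj, hg j hj]
  inv_mem' := by
    intro g hg j hj
    change g.symm (e K j) = e K j
    rw [LinearIsometryEquiv.symm_apply_eq, hg j hj]

end Groups

section Topology

variable {K : Type} [NormedRing K] [NormedAlgebra ℝ K]

instance : IsTopologicalGroup (UFull K) := by
  have hmul : ContinuousMul (UFull K) := continuousMul_induced (toOp K)
  refine { toContinuousMul := hmul, continuous_inv := ?_ }
  have hind : Topology.IsInducing (toOp K) := ⟨rfl⟩
  have key : ∀ g h : UFull K, ‖toOp K g⁻¹ - toOp K h⁻¹‖ ≤ ‖toOp K g - toOp K h‖ := by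
    intro g h
    refine ContinuousLinearMap.opNorm_le_bound _ (norm_nonneg _) fun x => ?_
    have h1 : (toOp K g⁻¹ - toOp K h⁻¹) x = g⁻¹ ((toOp K h - toOp K g) (h⁻¹ x)) := by
      have a : h (h⁻¹ x) = x := h.apply_symm_apply x
      have b : g⁻¹ (g (h⁻¹ x)) = h⁻¹ x := g.symm_apply_apply _
      simp only [sub_apply, toOp_apply, map_sub, a, b]
    rw [h1, LinearIsometryEquiv.norm_map, norm_sub_rev (toOp K g)]
    refine ((toOp K h - toOp K g).le_opNorm _).trans ?_
    rw [LinearIsometryEquiv.norm_map]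
  rw [hind.continuous_iff, continuous_iff_continuousAt]
  intro h
  have hc : Continuous (toOp K) := hind.continuous
  have ht : Filter.Tendsto (fun g => ‖toOp K g - toOp K h‖) (𝓝 h) (𝓝 0) := by
    have := ((hc.sub (continuous_const (y := toOp K h))).norm).tendsto h
    simpa using this
  exact tendsto_iff_norm_sub_tendsto_zero.2
    (squeeze_zero (fun _ => norm_nonneg _) (fun g => key g h) ht)

end Topology

/-- The identity component of a subgroup `S` of a topological group `G`, for the subspace topology
of `S`, regarded again as a subgroup of `G`. -/
def idComp {G : Type*} [Group G] [TopologicalSpace G] [IsTopologicalGroup G] (S : Subgroup G) :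
    Subgroup G :=
  (Subgroup.connectedComponentOfOne S).map S.subtype

theorem idComp_mono {G : Type*} [Group G] [TopologicalSpace G] [IsTopologicalGroup G]
    {S T : Subgroup G} (h : S ≤ T) : idComp S ≤ idComp T := by
  rintro _ ⟨g, hg, rfl⟩
  refine ⟨Subgroup.inclusion h g, ?_, rfl⟩
  have hc : Continuous (Subgroup.inclusion h) := continuous_inclusion h
  have := hc.image_connectedComponent_subset (1 : S) (Set.mem_image_of_mem _ hg)
  rwa [map_one] at this

section Groups

variable (K : Type) [NormedRing K] [NormedAlgebra ℝ K]

/-- The group `U_∞(ℓ²(ℕ, K))_0`, with the topology of the operator norm. -/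
def UCompact0 : Subgroup (UFull K) := idComp (UCompact K)

/-- The compact group `U(n, K)_0`. -/
def UFin0 (n : ℕ) : Subgroup (UFull K) := idComp (UFin K n)

variable {K} in
theorem UFin0_mono : Monotone (UFin0 K) := fun _ _ h =>
  idComp_mono fun _ hg j hj => hg j (h.trans hj)

/-- The direct limit group `U(∞, K)_0 = ⋃ n, U(n, K)_0`. -/
def UInf0 : Subgroup (UFull K) where
  carrier := {g | ∃ n, g ∈ UFin0 K n}
  one_mem' := ⟨0, one_mem _⟩
  mul_mem' := by
    rintro g h ⟨m, hm⟩ ⟨n, hn⟩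
    exact ⟨max m n, mul_mem (UFin0_mono (le_max_left m n) hm) (UFin0_mono (le_max_right m n) hn)⟩
  inv_mem' := by
    rintro g ⟨n, hn⟩
    exact ⟨n, inv_mem hn⟩

variable {K} in
theorem UFin0_le (n : ℕ) : UFin0 K n ≤ UInf0 K := fun _ hg => ⟨n, hg⟩

/-- The direct limit topology on `U(∞, K)_0`: the finest topology for which the inclusions of the
groups `U(n, K)_0` are continuous. (It is not the subspace topology of the operator norm.) -/
@[reducible] def dirLimTopology : TopologicalSpace (UInf0 K) :=
  ⨆ n, TopologicalSpace.coinduced (Subgroup.inclusion (UFin0_le (K := K) n)) inferInstance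

end Groups

section Inclusion

variable {K : Type} [NormedRing K] [NormedAlgebra ℝ K]

theorem single_eq_smul {K : Type} [NormedRing K] (j : ℕ) (a : K) :
    (lp.single 2 j a : Hilb K) = a • e K j := by
  rw [e, ← lp.single_smul, smul_eq_mul, mul_one]

/-- Elements of `U(n, K)` differ from `1` by an operator of finite rank. -/
theorem UFin_le_UCompact [FiniteDimensional ℝ K] (n : ℕ) : UFin K n ≤ UCompact K := by
  intro g hg
  -- the truncation to the first `n` coordinates, a map of finite rank
  let p : Hilb K →L[ℝ] (Fin n → K) :=
    ContinuousLinearMap.pi fun i => LinearMap.mkContinuous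
      ({ toFun := fun x => x i, map_add' := fun _ _ => rfl, map_smul' := fun _ _ => rfl } :
        Hilb K →ₗ[ℝ] K) 1
      (fun x => by
        rw [one_mul]
        exact lp.norm_apply_le_norm (by norm_num) x (i : ℕ))
  let q : (Fin n → K) →ₗ[ℝ] Hilb K := ∑ i : Fin n,
    ((toOp K g - 1 : Hilb K →L[ℝ] Hilb K) : Hilb K →ₗ[ℝ] Hilb K) ∘ₗ
      (lp.lsingle (E := fun _ : ℕ => K) (𝕜 := ℝ) 2 (i : ℕ) : K →ₗ[ℝ] Hilb K) ∘ₗ LinearMap.proj i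
  have hq : Continuous q := q.continuous_of_finiteDimensional
  have hid : IsCompactOperator (p : Hilb K → (Fin n → K)) :=
    have : ProperSpace (Fin n → K) := FiniteDimensional.proper ℝ _
    isCompactOperator_of_locallyCompactSpace_dom p
  have hqp : IsCompactOperator (q ∘ p) := hid.continuous_comp hq
  have heq : (fun x : Hilb K => g x - x) = q ∘ p := by
    funext x
    have hs : HasSum (fun j : ℕ => (toOp K g - 1) (lp.single 2 j (x j))) ((toOp K g - 1) x) :=
      (lp.hasSum_single (by norm_num) x).mapL (toOp K g - 1)
    have h0 : ∀ j ∉ Finset.range n, (toOp K g - 1) (lp.single 2 j (x j)) = 0 := by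
      intro j hj
      have hj' : n ≤ j := by simpa using hj
      rw [single_eq_smul]
      simp [hg j hj']
    have h1 := hs.unique (hasSum_sum_of_ne_finset_zero h0)
    have h2 : g x - x = (toOp K g - 1) x := by simp
    rw [h2, h1, Finset.sum_range]
    simp [q, p]
    rfl
  change IsCompactOperator _
  rw [heq]
  exact hqp

/-- `U(∞, K)_0 ⊆ U_∞(ℓ²(ℕ, K))_0`. -/
theorem UInf0_le_UCompact0 [FiniteDimensional ℝ K] : UInf0 K ≤ UCompact0 K := by
  rintro g ⟨n, hn⟩
  exact idComp_mono (UFin_le_UCompact n) hn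

end Inclusion

/-! ### Unitary representations

A unitary representation of `G` on a complex Hilbert space `V` is a homomorphism from `G` to the
group `V ≃ₗᵢ[ℂ] V` of unitary operators of `V`. -/

section Representations

variable {V : Type*} [NormedAddCommGroup V] [InnerProductSpace ℂ V]

/-- Continuity of a unitary representation: all orbit maps are continuous. -/
def IsContinuousRep {G : Type*} [Group G] (t : TopologicalSpace G) (π : G →* (V ≃ₗᵢ[ℂ] V)) : Prop :=
  ∀ v : V, Continuous[t, inferInstance] fun g => π g v

variable {K : Type} [NormedRing K] [NormedAlgebra ℝ K]

/-- The space of vectors fixed by the stabilizer in `U(∞, K)_0` of the first `n` basis vectors. -/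
def fixedSpace (π : UInf0 K →* (V ≃ₗᵢ[ℂ] V)) (n : ℕ) : Submodule ℂ V where
  carrier := {v | ∀ g : UInf0 K, (g : UFull K) ∈ stab K n → π g v = v}
  zero_mem' := fun g _ => map_zero (π g)
  add_mem' := by
    intro v w hv hw g hg
    rw [map_add, hv g hg, hw g hg]
  smul_mem' := by
    intro c v hv g hg
    rw [map_smul, hv g hg]

/-- Tameness: the union of the fixed spaces is dense. -/
def IsTame (π : UInf0 K →* (V ≃ₗᵢ[ℂ] V)) : Prop :=
  Dense (⋃ n, (fixedSpace π n : Set V))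

/-- `π` is the restriction of a norm-topology continuous unitary representation of
`U_∞(ℓ²(ℕ, K))_0` on the same Hilbert space. -/
def ExtendsContinuously [FiniteDimensional ℝ K] (π : UInf0 K →* (V ≃ₗᵢ[ℂ] V)) : Prop :=
  ∃ ρ : UCompact0 K →* (V ≃ₗᵢ[ℂ] V), IsContinuousRep inferInstance ρ ∧
    ρ.comp (Subgroup.inclusion UInf0_le_UCompact0) = π

end Representations

end TameRep

end

noncomputable section

open scoped Pointwise

set_option linter.unusedSectionVars false

namespace TameRep

/-! ### The `K`-valued inner product of `ℓ²(ℕ, K)` -/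

/-! Both conditions are compared with a third, `IsNormContinuous`: the orbit maps of `π` on U(∞,
K)_0 are continuous at `1` for the operator norm. A restriction from U_∞(ℓ²)_0 clearly has this
property. Conversely, U(∞, K)_0 is norm dense in U_∞(ℓ²)_0 (`UCompact0_le_topologicalClosure`):
elements near `1` are Cayley transforms of compact skew-adjoint operators, and these are norm limits
of their finite compressions. Since ‖π(g)v - π(h)v‖ = ‖π(h⁻¹g)v - v‖, the orbit maps then extend by
completeness (`exists_extension_of_isDenseInducing`).

Tame implies norm-continuous. By density it suffices to treat `v` fixed by the stabilizer of the
first `n` basis vectors. An element near `1` is stripped of its action on e_0, ..., e_{n-1} by `n`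
plane rotations, each taking e_i to a nearby vector. Such a rotation may involve arbitrarily many
coordinates, but conjugation by an element fixing `v` moves it into U(n+1, K)_0, where continuity
for the direct limit topology gives a uniform estimate (`exists_planeRot_small`,
`exists_norm_sub_lt_of_mem_stab`).

Norm-continuous implies tame. Let elements at distance less than `ε` from `1` move `v` only
slightly. Among the convex combinations of the corresponding vectors π(g)v with `g` finitely
supported, take `x` of nearly minimal norm. A small `g` supported beyond the coordinates used for
`x` keeps π(g)x in a hull of the same kind, because multiplying operators with disjoint supports
does not increase the distance from `1`; by the parallelogram law, `g` almost fixes `x`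
(`IsNormContinuous.exists_almost_fixed_small`).

To pass from small elements to the whole stabilizer, each of its elements is written as a product of
`N` small ones, with `N` depending on `ε` alone (`exists_uniform_pow`). A long product of small
elements is rearranged by an infinite-swindle argument: its factors are spread over disjoint blocks
by a shift `t`, at the price of one commutator with `t`, and `t` is a product of two rotations that
have small `N`-th roots. Finally, the element of least norm in the closed convex hull of the orbit
of `x` is a fixed vector near `v` (`exists_fixed_of_norm_sub_le`). -/

/-- Division rings with an involution satisfying `a a* = ‖a‖²`, such as `ℝ`, `ℂ` and `ℍ`. -/
class StarNormSq (K : Type) [NormedDivisionRing K] [NormedAlgebra ℝ K] [StarRing K] : Prop where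
  mul_star_self (a : K) : a * star a = algebraMap ℝ K (‖a‖ ^ 2)

section Form

variable {K : Type} [NormedDivisionRing K] [NormedAlgebra ℝ K]

theorem summable_norm_sq (x : Hilb K) : Summable fun j => ‖x j‖ ^ 2 := by
  have h := (lp.memℓp x).summable (by norm_num)
  simpa using h

theorem norm_sq_eq_tsum (x : Hilb K) : ‖x‖ ^ 2 = ∑' j, ‖x j‖ ^ 2 := by
  have h := lp.norm_rpow_eq_tsum (p := 2) (by norm_num) x
  simpa using h

theorem memℓp_two_of_summable {f : ℕ → K} (h : Summable fun j => ‖f j‖ ^ 2) :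
    Memℓp (E := fun _ : ℕ => K) f 2 :=
  memℓp_gen (by simpa using h)

@[simp] theorem add_coord (x y : Hilb K) (j : ℕ) : (x + y) j = x j + y j := rfl

@[simp] theorem sub_coord (x y : Hilb K) (j : ℕ) : (x - y) j = x j - y j := rfl

@[simp] theorem zero_coord (j : ℕ) : (0 : Hilb K) j = 0 := rfl

@[simp] theorem smul_coord (a : K) (x : Hilb K) (j : ℕ) : (a • x) j = a * x j := rfl

@[simp] theorem real_smul_coord (r : ℝ) (x : Hilb K) (j : ℕ) : (r • x) j = r • x j := rfl

theorem e_coord (i j : ℕ) : e K i j = if j = i then 1 else 0 := by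
  rw [e, lp.single_apply]
  by_cases h : j = i
  · subst h; simp
  · simp [h]

@[simp] theorem e_coord_self (i : ℕ) : e K i i = 1 := by simp [e_coord]

theorem e_coord_ne {i j : ℕ} (h : j ≠ i) : e K i j = 0 := by simp [e_coord, h]

@[simp] theorem norm_e (i : ℕ) : ‖e K i‖ = 1 := by
  rw [e, lp.norm_single (by norm_num)]; exact norm_one

theorem algebraMap_smul_eq (r : ℝ) (x : Hilb K) : algebraMap ℝ K r • x = r • x := by
  ext j
  simp [Algebra.smul_def]

theorem map_real_smul (g : UFull K) (r : ℝ) (x : Hilb K) : g (r • x) = r • g x := by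
  rw [← algebraMap_smul_eq, map_smul, algebraMap_smul_eq]

theorem smul_real_smul (a : K) (r : ℝ) (x : Hilb K) : a • r • x = r • a • x := by
  ext j
  simp

theorem hasSum_coord_smul_e (x : Hilb K) : HasSum (fun j => x j • e K j) x := by
  have h := lp.hasSum_single (E := fun _ : ℕ => K) (p := 2) (by norm_num) x
  simpa only [single_eq_smul] using h

/-- A bounded real-linear operator on `ℓ²` which commutes with scalars is determined by its values
on the part of the basis meeting the support of its argument. -/
theorem eqOn_of_eq_e {S T : Hilb K →L[ℝ] Hilb K} (hS : ∀ (a : K) x, S (a • x) = a • S x)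
    (hT : ∀ (a : K) x, T (a • x) = a • T x) {x : Hilb K}
    (h : ∀ j, x j ≠ 0 → S (e K j) = T (e K j)) : S x = T x := by
  have h1 := (hasSum_coord_smul_e x).mapL S
  have h2 := (hasSum_coord_smul_e x).mapL T
  refine h1.unique (h2.congr_fun fun j => ?_)
  rw [hS, hT]
  by_cases hj : x j = 0
  · simp [hj]
  · rw [h j hj]

theorem UFull.apply_eq_of_eq_e {g h : UFull K} {x : Hilb K}
    (H : ∀ j, x j ≠ 0 → g (e K j) = h (e K j)) : g x = h x :=
  eqOn_of_eq_e (S := toOp K g) (T := toOp K h) (fun a x => g.map_smul a x)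
    (fun a x => h.map_smul a x) H

theorem UFull.ext_e {g h : UFull K} (H : ∀ j, g (e K j) = h (e K j)) : g = h :=
  LinearIsometryEquiv.ext fun _ => UFull.apply_eq_of_eq_e fun j _ => H j

theorem UFull.apply_eq_self {g : UFull K} {x : Hilb K}
    (H : ∀ j, x j ≠ 0 → g (e K j) = e K j) : g x = x :=
  UFull.apply_eq_of_eq_e (h := 1) H

variable [StarRing K]

/-- The `K`-valued inner product `∑ x_j y_j*`, linear in the first argument. -/
def form (x y : Hilb K) : K := ∑' j, x j * star (y j)

variable [StarNormSq K]

theorem mul_star_self' (a : K) : a * star a = algebraMap ℝ K (‖a‖ ^ 2) :=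
  StarNormSq.mul_star_self a

theorem norm_star' (a : K) : ‖star a‖ = ‖a‖ := by
  by_cases h : a = 0
  · simp [h]
  have h1 : ‖a‖ * ‖star a‖ = ‖a‖ ^ 2 := by
    rw [← norm_mul, mul_star_self', norm_algebraMap']
    simp
  have h2 : ‖a‖ ≠ 0 := norm_ne_zero_iff.2 h
  rw [sq] at h1
  exact mul_left_cancel₀ h2 h1

/-- `StarNormSq` does not postulate that the involution is real-linear. A nonnegative real is `b *
star b` for its square root `b`, hence self-adjoint, and negatives follow. -/
theorem star_algebraMap (r : ℝ) : star (algebraMap ℝ K r) = algebraMap ℝ K r := by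
  have h0 : ∀ r : ℝ, 0 ≤ r → star (algebraMap ℝ K r) = algebraMap ℝ K r := by
    intro r hr
    have h : algebraMap ℝ K r = algebraMap ℝ K √r * star (algebraMap ℝ K √r) := by
      rw [mul_star_self', norm_algebraMap']
      simp [Real.sq_sqrt hr]
    rw [h, star_mul, star_star]
  rcases le_total 0 r with h | h
  · exact h0 r h
  · have := h0 (-r) (by linarith)
    simpa using this

theorem star_real_smul (r : ℝ) (a : K) : star (r • a) = r • star a := by
  rw [Algebra.smul_def, star_mul, star_algebraMap, Algebra.smul_def, Algebra.commutes]

instance (priority := 100) : ContinuousStar K where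
  continuous_star := by
    have : Isometry (star : K → K) := by
      refine Isometry.of_dist_eq fun a b => ?_
      rw [dist_eq_norm, dist_eq_norm, ← star_sub, norm_star']
    exact this.continuous

theorem star_mul_self' (a : K) : star a * a = algebraMap ℝ K (‖a‖ ^ 2) := by
  have := mul_star_self' (star a)
  rwa [star_star, norm_star'] at this

theorem summable_norm_form (x y : Hilb K) : Summable fun j => ‖x j * star (y j)‖ := by
  have := lp.summable_mul (p := 2) (q := 2) (by norm_num; exact Real.HolderConjugate.two_two) x y
  simpa only [norm_mul, norm_star'] using this

variable [FiniteDimensional ℝ K]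

instance (priority := 100) completeSpace_scalars : CompleteSpace K :=
  FiniteDimensional.complete ℝ K

theorem summable_form (x y : Hilb K) : Summable fun j => x j * star (y j) :=
  (summable_norm_form x y).of_norm

theorem norm_form_le (x y : Hilb K) : ‖form x y‖ ≤ ‖x‖ * ‖y‖ := by
  refine (norm_tsum_le_tsum_norm (summable_norm_form x y)).trans ?_
  have := lp.tsum_mul_le_mul_norm (p := 2) (q := 2)
    (by norm_num; exact Real.HolderConjugate.two_two) x y
  simpa only [norm_mul, norm_star'] using this.2

theorem form_add_left (x x' y : Hilb K) : form (x + x') y = form x y + form x' y := by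
  rw [form, form, form, ← (summable_form x y).tsum_add (summable_form x' y)]
  exact tsum_congr fun j => add_mul _ _ _

theorem form_smul_left (a : K) (x y : Hilb K) : form (a • x) y = a * form x y := by
  rw [form, form, ← (summable_form x y).tsum_mul_left]
  exact tsum_congr fun j => mul_assoc _ _ _

theorem star_form (x y : Hilb K) : star (form x y) = form y x := by
  rw [form, form, tsum_star]
  exact tsum_congr fun j => by rw [star_mul, star_star]

theorem form_add_right (x y y' : Hilb K) : form x (y + y') = form x y + form x y' := by
  rw [← star_form, form_add_left, star_add, star_form, star_form]

theorem form_smul_right (a : K) (x y : Hilb K) : form x (a • y) = form x y * star a := by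
  rw [← star_form, form_smul_left, star_mul, star_form]

theorem form_real_smul_left (r : ℝ) (x y : Hilb K) : form (r • x) y = r • form x y := by
  rw [← algebraMap_smul_eq, form_smul_left, Algebra.smul_def]

theorem form_real_smul_right (r : ℝ) (x y : Hilb K) : form x (r • y) = r • form x y := by
  rw [← algebraMap_smul_eq, form_smul_right, star_algebraMap, Algebra.smul_def, Algebra.commutes]

theorem form_neg_left (x y : Hilb K) : form (-x) y = -form x y := by
  have := form_smul_left (-1 : K) x y
  simpa using this

theorem form_neg_right (x y : Hilb K) : form x (-y) = -form x y := by
  have := form_smul_right (-1 : K) x y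
  simpa using this

theorem form_sub_left (x x' y : Hilb K) : form (x - x') y = form x y - form x' y := by
  rw [sub_eq_add_neg, form_add_left, form_neg_left, sub_eq_add_neg]

theorem form_sub_right (x y y' : Hilb K) : form x (y - y') = form x y - form x y' := by
  rw [sub_eq_add_neg, form_add_right, form_neg_right, sub_eq_add_neg]

theorem form_self (x : Hilb K) : form x x = algebraMap ℝ K (‖x‖ ^ 2) := by
  rw [norm_sq_eq_tsum, form]
  have h := (summable_norm_sq x).hasSum.mapL (Algebra.linearMap ℝ K).toContinuousLinearMap
  simp only [mul_star_self']
  exact h.tsum_eq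

theorem norm_form_self (x : Hilb K) : ‖form x x‖ = ‖x‖ ^ 2 := by
  rw [form_self, norm_algebraMap']; simp

theorem form_self_of_norm_one {x : Hilb K} (h : ‖x‖ = 1) : form x x = 1 := by
  rw [form_self, h]; simp

theorem form_e_right (x : Hilb K) (j : ℕ) : form x (e K j) = x j := by
  rw [form, tsum_eq_single j]
  · simp
  · intro i hi
    simp [e_coord_ne hi]

theorem form_e_left (x : Hilb K) (j : ℕ) : form (e K j) x = star (x j) := by
  rw [← star_form, form_e_right]

/-- The real part of the form is determined by the norms of `x`, `y` and `x + y`. -/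
theorem form_add_form_swap (x y : Hilb K) :
    form x y + form y x = algebraMap ℝ K (‖x + y‖ ^ 2 - ‖x‖ ^ 2 - ‖y‖ ^ 2) := by
  rw [map_sub, map_sub, ← form_self, ← form_self, ← form_self]
  simp only [form_add_left, form_add_right]
  abel

/-- Polarization only recovers the real part of the form. Replacing `x` by `a • x` for all scalars
`a` recovers the rest: the defect `d` satisfies `a d + (a d)* = 0`, and `a = star d` gives `2 ‖d‖² =
0`. -/
theorem form_map (g : UFull K) (x y : Hilb K) : form (g x) (g y) = form x y := by
  have key : ∀ a : K, a * (form (g x) (g y) - form x y) +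
      star (form (g x) (g y) - form x y) * star a = 0 := by
    intro a
    have h1 := form_add_form_swap (g (a • x)) (g y)
    rw [← map_add, LinearIsometryEquiv.norm_map, LinearIsometryEquiv.norm_map,
      LinearIsometryEquiv.norm_map, ← form_add_form_swap, map_smul, form_smul_left,
      form_smul_right, form_smul_left, form_smul_right] at h1
    rw [star_sub, star_form, star_form, mul_sub, sub_mul, sub_add_sub_comm, h1, sub_self]
  set d := form (g x) (g y) - form x y with hd
  have h := key (star d)
  rw [star_star, star_mul_self', ← map_add, ← two_mul] at h
  have h' : (2 * ‖d‖ ^ 2 : ℝ) = 0 := by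
    have := (algebraMap ℝ K).injective (h.trans (map_zero _).symm)
    exact this
  have : d = 0 := by simpa using h'
  exact sub_eq_zero.1 this

theorem form_apply_left (g : UFull K) (x y : Hilb K) : form (g x) y = form x (g⁻¹ y) := by
  have h : g (g⁻¹ y) = y := g.apply_symm_apply y
  rw [← form_map g x, h]

theorem form_inv_apply_left (g : UFull K) (x y : Hilb K) : form (g⁻¹ x) y = form x (g y) := by
  rw [form_apply_left, inv_inv]

/-- A unitary operator fixing `e_j` does not change the `j`-th coordinate. -/
theorem UFull.coord_eq {g : UFull K} {j : ℕ} (h : g (e K j) = e K j) (x : Hilb K) :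
    g x j = x j := by
  rw [← form_e_right, ← form_e_right, ← form_map g x, h]

/-- The inner product as a continuous real-bilinear map. -/
def formL : Hilb K →L[ℝ] Hilb K →L[ℝ] K :=
  LinearMap.mkContinuous₂ (LinearMap.mk₂ ℝ form form_add_left form_real_smul_left
    form_add_right form_real_smul_right) 1 fun x y => by
      rw [one_mul]; exact norm_form_le x y

theorem continuous_form : Continuous fun p : Hilb K × Hilb K => form p.1 p.2 := by
  have : Continuous fun p : Hilb K × Hilb K => formL p.1 p.2 := by fun_prop
  exact this

end Form

/-! ### Construction of unitary operators -/

section Unitary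

variable {K : Type} [NormedDivisionRing K] [NormedAlgebra ℝ K]

/-- A unitary operator from a bounded real-linear isometry which commutes with scalars, and its
inverse. -/
def mkU (T : Hilb K →L[ℝ] Hilb K) (T' : Hilb K → Hilb K) (hK : ∀ (a : K) x, T (a • x) = a • T x)
    (hl : ∀ x, T' (T x) = x) (hr : ∀ x, T (T' x) = x) (hn : ∀ x, ‖T x‖ = ‖x‖) : UFull K where
  toFun := T
  invFun := T'
  map_add' := T.map_add
  map_smul' := hK
  left_inv := hl
  right_inv := hr
  norm_map' := hn

@[simp] theorem UFull.mul_apply (g h : UFull K) (x : Hilb K) : (g * h) x = g (h x) := rfl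

@[simp] theorem UFull.inv_apply_self (g : UFull K) (x : Hilb K) : g⁻¹ (g x) = x :=
  g.symm_apply_apply x

@[simp] theorem UFull.apply_inv_self (g : UFull K) (x : Hilb K) : g (g⁻¹ x) = x :=
  g.apply_symm_apply x

theorem UFull.inv_apply_eq {g : UFull K} {x y : Hilb K} (h : g x = y) : g⁻¹ y = x := by
  rw [← h, inv_apply_self]

theorem norm_apply_sub_le {g : UFull K} {c : ℝ} (h : ‖toOp K g - 1‖ ≤ c) (x : Hilb K) :
    ‖g x - x‖ ≤ c * ‖x‖ := by
  have := (toOp K g - 1).le_of_opNorm_le h x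
  simpa using this

theorem norm_toOp_sub_one_le {g : UFull K} {c : ℝ} (hc : 0 ≤ c)
    (h : ∀ x, ‖g x - x‖ ≤ c * ‖x‖) : ‖toOp K g - 1‖ ≤ c :=
  ContinuousLinearMap.opNorm_le_bound _ hc fun x => by simpa using h x

theorem norm_toOp_inv_sub_one (g : UFull K) : ‖toOp K g⁻¹ - 1‖ = ‖toOp K g - 1‖ := by
  have key : ∀ g : UFull K, ‖toOp K g⁻¹ - 1‖ ≤ ‖toOp K g - 1‖ := by
    intro g
    refine norm_toOp_sub_one_le (norm_nonneg _) fun x => ?_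
    have h := norm_apply_sub_le (le_refl ‖toOp K g - 1‖) (g⁻¹ x)
    rw [UFull.apply_inv_self, norm_sub_rev, LinearIsometryEquiv.norm_map] at h
    exact h
  refine le_antisymm (key g) ?_
  simpa using key g⁻¹

theorem norm_toOp_mul_sub_one_le (g h : UFull K) :
    ‖toOp K (g * h) - 1‖ ≤ ‖toOp K g - 1‖ + ‖toOp K h - 1‖ := by
  refine norm_toOp_sub_one_le (by positivity) fun x => ?_
  have h1 := norm_apply_sub_le (le_refl ‖toOp K g - 1‖) (h x)
  have h2 := norm_apply_sub_le (le_refl ‖toOp K h - 1‖) x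
  rw [LinearIsometryEquiv.norm_map] at h1
  have h3 := norm_add_le (g (h x) - h x) (h x - x)
  rw [sub_add_sub_cancel] at h3
  rw [UFull.mul_apply, add_mul]
  linarith

theorem norm_toOp_conj_sub_one (u g : UFull K) :
    ‖toOp K (u * g * u⁻¹) - 1‖ = ‖toOp K g - 1‖ := by
  have key : ∀ u g : UFull K, ‖toOp K (u * g * u⁻¹) - 1‖ ≤ ‖toOp K g - 1‖ := by
    intro u g
    refine norm_toOp_sub_one_le (norm_nonneg _) fun x => ?_
    have h := norm_apply_sub_le (le_refl ‖toOp K g - 1‖) (u⁻¹ x)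
    rw [LinearIsometryEquiv.norm_map] at h
    rw [UFull.mul_apply, UFull.mul_apply]
    conv_lhs => rw [← u.apply_symm_apply x]
    change ‖u (g (u⁻¹ (u (u⁻¹ x)))) - u (u⁻¹ x)‖ ≤ _
    rwa [← map_sub, LinearIsometryEquiv.norm_map, UFull.inv_apply_self]
  refine le_antisymm (key u g) ?_
  have := key u⁻¹ (u * g * u⁻¹)
  simpa [mul_assoc] using this

theorem isInducing_toOp : Topology.IsInducing (toOp K) := ⟨rfl⟩

theorem mem_nhds_one_iff {s : Set (UFull K)} :
    s ∈ 𝓝 (1 : UFull K) ↔ ∃ ε > 0, ∀ g : UFull K, ‖toOp K g - 1‖ < ε → g ∈ s := by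
  rw [isInducing_toOp.nhds_eq_comap, map_one, (Metric.nhds_basis_ball.comap _).mem_iff]
  simp only [Set.subset_def, Set.mem_preimage, Metric.mem_ball, dist_eq_norm]

theorem ball_mem_nhds_one {ε : ℝ} (hε : 0 < ε) :
    {g : UFull K | ‖toOp K g - 1‖ < ε} ∈ 𝓝 (1 : UFull K) :=
  mem_nhds_one_iff.2 ⟨ε, hε, fun _ h => h⟩

/-! ### Truncations and disjoint supports -/

open Classical in
/-- The projection onto the closed span of the basis vectors with index in `S`. -/
def proj (S : Set ℕ) : Hilb K →L[ℝ] Hilb K :=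
  LinearMap.mkContinuous
    { toFun := fun x => ⟨fun j => if j ∈ S then x j else 0, memℓp_two_of_summable
        ((summable_norm_sq x).of_nonneg_of_le (fun _ => by positivity) fun j => by
          split_ifs <;> simp)⟩
      map_add' := fun x y => by
        ext j
        by_cases h : j ∈ S <;> simp [h]
      map_smul' := fun r x => by
        ext j
        by_cases h : j ∈ S <;> simp [h] } 1 fun x => by
    rw [one_mul]
    refine lp.norm_mono (by norm_num) fun j => ?_
    by_cases h : j ∈ S <;> simp [h]

open Classical in
theorem proj_coord (S : Set ℕ) (x : Hilb K) (j : ℕ) : proj S x j = if j ∈ S then x j else 0 := rfl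

theorem proj_coord_mem {S : Set ℕ} {j : ℕ} (h : j ∈ S) (x : Hilb K) : proj S x j = x j := by
  simp [proj_coord, h]

theorem proj_coord_notMem {S : Set ℕ} {j : ℕ} (h : j ∉ S) (x : Hilb K) : proj S x j = 0 := by
  simp [proj_coord, h]

theorem norm_proj_le (S : Set ℕ) : ‖(proj S : Hilb K →L[ℝ] Hilb K)‖ ≤ 1 :=
  LinearMap.mkContinuous_norm_le _ zero_le_one _

theorem proj_smul (S : Set ℕ) (a : K) (x : Hilb K) : proj S (a • x) = a • proj S x := by
  ext j
  by_cases h : j ∈ S <;> simp [proj_coord, h]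

theorem proj_add_proj_compl (S : Set ℕ) (x : Hilb K) : proj S x + proj Sᶜ x = x := by
  ext j
  by_cases h : j ∈ S <;> simp [proj_coord, h]

theorem norm_sq_add_of_disjoint {x y : Hilb K} (h : ∀ j, x j = 0 ∨ y j = 0) :
    ‖x + y‖ ^ 2 = ‖x‖ ^ 2 + ‖y‖ ^ 2 := by
  rw [norm_sq_eq_tsum, norm_sq_eq_tsum, norm_sq_eq_tsum,
    ← (summable_norm_sq x).tsum_add (summable_norm_sq y)]
  refine tsum_congr fun j => ?_
  rcases h j with h | h <;> simp [h]

variable [StarRing K] [StarNormSq K] [FiniteDimensional ℝ K]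

/-- The product of two unitary operators with disjoint supports is not further from `1` than the
factors. -/
theorem norm_toOp_mul_sub_one_le_of_disjoint {S : Set ℕ} {g h : UFull K} {c : ℝ}
    (hg : ∀ j ∉ S, g (e K j) = e K j) (hh : ∀ j ∈ S, h (e K j) = e K j)
    (hgc : ‖toOp K g - 1‖ ≤ c) (hhc : ‖toOp K h - 1‖ ≤ c) : ‖toOp K (g * h) - 1‖ ≤ c := by
  have hc : 0 ≤ c := (norm_nonneg _).trans hgc
  refine norm_toOp_sub_one_le hc fun x => ?_
  set p := proj S x with hp
  set q := proj Sᶜ x with hq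
  have hx : p + q = x := proj_add_proj_compl S x
  have hp0 : ∀ j ∉ S, p j = 0 := fun j hj => proj_coord_notMem hj x
  have hq0 : ∀ j ∈ S, q j = 0 := fun j hj => proj_coord_notMem (by simpa using hj) x
  have h1 : h p = p := UFull.apply_eq_self fun j hj => hh j (by_contra fun H => hj (hp0 j H))
  have h2 : ∀ j ∈ S, h q j = 0 := fun j hj => by rw [UFull.coord_eq (hh j hj), hq0 j hj]
  have h3 : g (h q) = h q := UFull.apply_eq_self fun j hj => hg j fun H => hj (h2 j H)
  have h4 : ∀ j ∉ S, (g p - p) j = 0 := fun j hj => by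
    rw [sub_coord, UFull.coord_eq (hg j hj), sub_self]
  have h5 : (g * h) x - x = (g p - p) + (h q - q) := by
    rw [← hx, UFull.mul_apply, map_add, h1, map_add, h3]; abel
  have h6 : ‖(g * h) x - x‖ ^ 2 = ‖g p - p‖ ^ 2 + ‖h q - q‖ ^ 2 := by
    rw [h5]
    refine norm_sq_add_of_disjoint fun j => ?_
    by_cases hj : j ∈ S
    · right; rw [sub_coord, h2 j hj, hq0 j hj, sub_zero]
    · left; exact h4 j hj
  have h7 : ‖x‖ ^ 2 = ‖p‖ ^ 2 + ‖q‖ ^ 2 := by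
    rw [← hx]
    refine norm_sq_add_of_disjoint fun j => ?_
    by_cases hj : j ∈ S
    · right; exact hq0 j hj
    · left; exact hp0 j hj
  have h8 := norm_apply_sub_le hgc p
  have h9 := norm_apply_sub_le hhc q
  refine (sq_le_sq₀ (norm_nonneg _) (by positivity)).1 ?_
  rw [h6, mul_pow, h7, mul_add, ← mul_pow, ← mul_pow]
  gcongr

/-- Unitary operators with disjoint supports commute. -/
theorem mul_comm_of_disjoint {S : Set ℕ} {g h : UFull K}
    (hg : ∀ j ∉ S, g (e K j) = e K j) (hh : ∀ j ∈ S, h (e K j) = e K j) : g * h = h * g := by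
  refine UFull.ext_e fun j => ?_
  rw [UFull.mul_apply, UFull.mul_apply]
  by_cases hj : j ∈ S
  · rw [hh j hj]
    refine (UFull.apply_eq_self fun i hi => hh i ?_).symm
    by_contra H
    rw [UFull.coord_eq (hg i H), e_coord_ne (by rintro rfl; exact H hj)] at hi
    exact hi rfl
  · rw [hg j hj]
    refine UFull.apply_eq_self fun i hi => hg i fun H => hi ?_
    rw [UFull.coord_eq (hh i H), e_coord_ne (by rintro rfl; exact hj H)]

end Unitary

/-! ### Identity components -/

section IdComp

variable {G : Type*} [Group G] [TopologicalSpace G] [IsTopologicalGroup G]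

theorem idComp_le (S : Subgroup G) : idComp S ≤ S := by
  rintro _ ⟨g, -, rfl⟩
  exact g.2

theorem isPreconnected_idComp (S : Subgroup G) : IsPreconnected (idComp S : Set G) :=
  isPreconnected_connectedComponent.image _ continuous_subtype_val.continuousOn

theorem subset_idComp {S : Subgroup G} {s : Set G} (hs : IsPreconnected s) (hS : s ⊆ S)
    (h1 : (1 : G) ∈ s) : s ⊆ idComp S := by
  intro g hg
  have hpre : IsPreconnected (Subtype.val ⁻¹' s : Set S) := by
    refine Topology.IsInducing.subtypeVal.isPreconnected_image.1 ?_
    convert hs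
    ext x
    exact ⟨by rintro ⟨y, hy, rfl⟩; exact hy, fun hx => ⟨⟨x, hS hx⟩, hx, rfl⟩⟩
  exact ⟨⟨g, hS hg⟩, hpre.subset_connectedComponent (x := (1 : S)) h1 hg, rfl⟩

theorem mem_idComp_of_path {S : Subgroup G} {γ : ℝ → G} (hc : ContinuousOn γ (Set.Icc 0 1))
    (hS : ∀ t ∈ Set.Icc (0 : ℝ) 1, γ t ∈ S) (h0 : γ 0 = 1) : γ 1 ∈ idComp S :=
  subset_idComp (isPreconnected_Icc.image γ hc) (by rintro _ ⟨t, ht, rfl⟩; exact hS t ht)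
    ⟨0, by simp, h0⟩ ⟨1, by simp, rfl⟩

theorem conj_mem_idComp {S T : Subgroup G} {u : G} (h : ∀ g ∈ S, u * g * u⁻¹ ∈ T) {g : G}
    (hg : g ∈ idComp S) : u * g * u⁻¹ ∈ idComp T := by
  refine subset_idComp (s := (fun g => u * g * u⁻¹) '' (idComp S : Set G))
    ((isPreconnected_idComp S).image _ (by fun_prop)) ?_ ⟨1, one_mem _, by simp⟩ ⟨g, hg, rfl⟩
  rintro _ ⟨k, hk, rfl⟩
  exact h k (idComp_le S hk)

/-- A connected topological group has no proper open subgroup, so any neighbourhood of `1` generates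
it. -/
theorem idComp_le_closure (S : Subgroup G) {U : Set G} (hU : U ∈ 𝓝 (1 : G)) :
    idComp S ≤ Subgroup.closure (U ∩ idComp S) := by
  set H := (Subgroup.closure (U ∩ idComp S)).subgroupOf (idComp S) with hH
  have hmem : (H : Set (idComp S)) ∈ 𝓝 (1 : idComp S) := by
    have h1 : (Subtype.val ⁻¹' U : Set (idComp S)) ∈ 𝓝 (1 : idComp S) :=
      continuous_subtype_val.continuousAt.preimage_mem_nhds hU
    exact Filter.mem_of_superset h1 fun g hg => Subgroup.subset_closure ⟨hg, g.2⟩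
  have ho : IsOpen (H : Set (idComp S)) := H.isOpen_of_mem_nhds hmem
  have : PreconnectedSpace (idComp S) :=
    isPreconnected_iff_preconnectedSpace.1 (isPreconnected_idComp S)
  have hu : (H : Set (idComp S)) = Set.univ :=
    IsClopen.eq_univ ⟨H.isClosed_of_isOpen ho, ho⟩ ⟨1, one_mem H⟩
  intro g hg
  have : (⟨g, hg⟩ : idComp S) ∈ (H : Set (idComp S)) := hu ▸ Set.mem_univ _
  exact this

end IdComp

/-! ### Conjugation of finitely supported operators -/

section Conjugation

variable {K : Type} [NormedDivisionRing K] [NormedAlgebra ℝ K] [StarRing K] [StarNormSq K]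
  [FiniteDimensional ℝ K]

variable (K) in
/-- The operators mapping finitely supported vectors to finitely supported vectors. -/
def PreservesFinSupp : Submonoid (UFull K) where
  carrier := {u | ∀ M, ∃ M', ∀ x : Hilb K, (∀ k, M ≤ k → x k = 0) → ∀ k, M' ≤ k → u x k = 0}
  one_mem' := fun M => ⟨M, fun _ hx => hx⟩
  mul_mem' := by
    intro g h hg hh M
    obtain ⟨M', hM'⟩ := hh M
    obtain ⟨M'', hM''⟩ := hg M'
    exact ⟨M'', fun x hx => hM'' _ (hM' x hx)⟩

theorem inv_apply_e_coord (u : UFull K) (j k : ℕ) : u⁻¹ (e K k) j = star (u (e K j) k) := by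
  rw [← form_e_right, form_inv_apply_left, form_e_left]

/-- `u g u⁻¹` fixes `e_k` if `u` maps the support of `g` to the orthogonal complement of `e_k`. -/
theorem conj_apply_e {u g : UFull K} {k : ℕ}
    (h : ∀ j, g (e K j) = e K j ∨ u (e K j) k = 0) : (u * g * u⁻¹) (e K k) = e K k := by
  have hg : g (u⁻¹ (e K k)) = u⁻¹ (e K k) := UFull.apply_eq_self fun j hj =>
    (h j).resolve_right fun H => hj (by rw [inv_apply_e_coord, H, star_zero])
  rw [UFull.mul_apply, UFull.mul_apply, hg, UFull.apply_inv_self]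

theorem conj_mem_UInf0 {u g : UFull K} (hu : u ∈ PreservesFinSupp K) (hg : g ∈ UInf0 K) :
    u * g * u⁻¹ ∈ UInf0 K := by
  obtain ⟨M, hM⟩ := hg
  obtain ⟨M', hM'⟩ := hu M
  refine ⟨M', conj_mem_idComp (S := UFin K M) (T := UFin K M') (fun g hg => ?_) hM⟩
  intro k hk
  refine conj_apply_e fun j => ?_
  rcases lt_or_ge j M with h | h
  · exact Or.inr (hM' _ (fun k hk => e_coord_ne (by omega)) k hk)
  · exact Or.inl (hg j h)

theorem UFin_le_preservesFinSupp {n : ℕ} {u : UFull K} (hu : u ∈ UFin K n) :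
    u ∈ PreservesFinSupp K := fun M => ⟨max M n, fun x hx k hk => by
  rw [UFull.coord_eq (hu k ((le_max_right M n).trans hk)), hx k ((le_max_left M n).trans hk)]⟩

theorem UInf0_le_preservesFinSupp {u : UFull K} (hu : u ∈ UInf0 K) : u ∈ PreservesFinSupp K := by
  obtain ⟨n, hn⟩ := hu
  exact UFin_le_preservesFinSupp (idComp_le _ hn)

end Conjugation

/-! ### Rotations in pairwise orthogonal coordinate planes -/

section Rotations

/-- An involution of `ℕ` with symmetric diagonal and antisymmetric off-diagonal coefficients. -/
structure PairCoeff where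
  τ : ℕ → ℕ
  α : ℕ → ℝ
  β : ℕ → ℝ
  C : ℝ
  τ_τ : ∀ k, τ (τ k) = k
  α_τ : ∀ k, α (τ k) = α k
  β_τ : ∀ k, β (τ k) = -β k
  le_C : ∀ k, α k ^ 2 + β k ^ 2 ≤ C

variable {K : Type} [NormedDivisionRing K] [NormedAlgebra ℝ K] [StarRing K] [StarNormSq K]

theorem norm_sq_pair (a b : ℝ) (x y : K) :
    ‖a • x + b • y‖ ^ 2 + ‖a • y - b • x‖ ^ 2 = (a ^ 2 + b ^ 2) * (‖x‖ ^ 2 + ‖y‖ ^ 2) := by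
  refine (algebraMap ℝ K).injective ?_
  rw [map_add, map_mul, map_add _ (‖x‖ ^ 2), ← mul_star_self', ← mul_star_self', ← mul_star_self',
    ← mul_star_self', ← Algebra.smul_def]
  simp only [star_add, star_sub, star_real_smul, mul_add, add_mul, mul_sub, sub_mul,
    smul_mul_assoc, mul_smul_comm]
  module

namespace PairCoeff

variable (P : PairCoeff)

/-- The involution as a permutation. -/
def perm : Equiv.Perm ℕ := ⟨P.τ, P.τ, P.τ_τ, P.τ_τ⟩

theorem pair_eq (x : ℕ → K) (k : ℕ) :
    ‖P.α k • x k + P.β k • x (P.τ k)‖ ^ 2 +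
      ‖P.α (P.τ k) • x (P.τ k) + P.β (P.τ k) • x (P.τ (P.τ k))‖ ^ 2 =
      (P.α k ^ 2 + P.β k ^ 2) * (‖x k‖ ^ 2 + ‖x (P.τ k)‖ ^ 2) := by
  rw [P.α_τ, P.β_τ, P.τ_τ, neg_smul, ← sub_eq_add_neg, norm_sq_pair]

theorem summable_coord (x : Hilb K) :
    Summable fun k => ‖P.α k • x k + P.β k • x (P.τ k)‖ ^ 2 := by
  have h1 : Summable fun k => ‖x (P.τ k)‖ ^ 2 := P.perm.summable_iff.2 (summable_norm_sq x)
  refine (((summable_norm_sq x).add h1).mul_left P.C).of_nonneg_of_le (fun _ => by positivity)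
    fun k => ?_
  have h2 := P.pair_eq x k
  have h3 := mul_le_mul_of_nonneg_right (P.le_C k)
    (show 0 ≤ ‖x k‖ ^ 2 + ‖x (P.τ k)‖ ^ 2 by positivity)
  have h4 : 0 ≤ ‖P.α (P.τ k) • x (P.τ k) + P.β (P.τ k) • x (P.τ (P.τ k))‖ ^ 2 := by positivity
  linarith

theorem summable_coeff (x : Hilb K) : Summable fun k => (P.α k ^ 2 + P.β k ^ 2) * ‖x k‖ ^ 2 :=
  ((summable_norm_sq x).mul_left P.C).of_nonneg_of_le (fun _ => by positivity) fun k =>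
    mul_le_mul_of_nonneg_right (P.le_C k) (by positivity)

/-- On an orbit `{k, τ k}` the antisymmetry of `β` cancels the cross terms. Summing the identity
`pair_eq` over all `k` counts each of the two series twice. -/
theorem tsum_coord (x : Hilb K) : ∑' k, ‖P.α k • x k + P.β k • x (P.τ k)‖ ^ 2 =
    ∑' k, (P.α k ^ 2 + P.β k ^ 2) * ‖x k‖ ^ 2 := by
  have hs := P.summable_coord x
  have hs' := P.summable_coeff x
  have h1 := (P.perm.tsum_eq fun k => ‖P.α k • x k + P.β k • x (P.τ k)‖ ^ 2)
  have h2 := (P.perm.tsum_eq fun k => (P.α k ^ 2 + P.β k ^ 2) * ‖x k‖ ^ 2)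
  have h3 := hs.tsum_add (P.perm.summable_iff.2 hs)
  have h4 := hs'.tsum_add (P.perm.summable_iff.2 hs')
  have h5 : ∀ k, ‖P.α k • x k + P.β k • x (P.τ k)‖ ^ 2 +
      ((fun k => ‖P.α k • x k + P.β k • x (P.τ k)‖ ^ 2) ∘ P.perm) k =
      (P.α k ^ 2 + P.β k ^ 2) * ‖x k‖ ^ 2 +
      ((fun k => (P.α k ^ 2 + P.β k ^ 2) * ‖x k‖ ^ 2) ∘ P.perm) k := by
    intro k
    refine (P.pair_eq x k).trans ?_
    simp only [Function.comp, perm, Equiv.coe_fn_mk, P.α_τ, P.β_τ]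
    ring
  rw [tsum_congr h5, h4] at h3
  have h1' : ∑' k, ((fun k => ‖P.α k • x k + P.β k • x (P.τ k)‖ ^ 2) ∘ P.perm) k = _ := h1
  have h2' : ∑' k, ((fun k => (P.α k ^ 2 + P.β k ^ 2) * ‖x k‖ ^ 2) ∘ P.perm) k = _ := h2
  linarith

/-- The operator with the given coefficients. -/
def op : Hilb K →L[ℝ] Hilb K :=
  LinearMap.mkContinuous
    { toFun := fun x => ⟨fun k => P.α k • x k + P.β k • x (P.τ k),
        memℓp_two_of_summable (P.summable_coord x)⟩
      map_add' := fun x y => by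
        ext k
        simp only [add_coord, smul_add]
        abel
      map_smul' := fun r x => by
        ext k
        simp only [real_smul_coord, RingHom.id_apply, smul_add]
        rw [smul_comm r, smul_comm r] } √P.C fun x => by
    have hC : 0 ≤ P.C := le_trans (by positivity) (P.le_C 0)
    refine (sq_le_sq₀ (norm_nonneg _) (by positivity)).1 ?_
    rw [norm_sq_eq_tsum, mul_pow, Real.sq_sqrt hC, norm_sq_eq_tsum, ← tsum_mul_left]
    refine (P.tsum_coord x).trans_le ?_
    exact (P.summable_coeff x).tsum_le_tsum
      (fun k => mul_le_mul_of_nonneg_right (P.le_C k) (by positivity))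
      ((summable_norm_sq x).mul_left P.C)

theorem op_coord (x : Hilb K) (k : ℕ) : P.op x k = P.α k • x k + P.β k • x (P.τ k) := rfl

theorem op_smul (a : K) (x : Hilb K) : P.op (a • x) = a • P.op x := by
  ext k
  simp only [op_coord, smul_coord, mul_add, mul_smul_comm]

theorem norm_sq_op (x : Hilb K) : ‖P.op x‖ ^ 2 = ∑' k, (P.α k ^ 2 + P.β k ^ 2) * ‖x k‖ ^ 2 := by
  rw [norm_sq_eq_tsum]
  exact P.tsum_coord x

end PairCoeff

/-- Oriented pairs of natural numbers: `τ` exchanges the members of each pair, `η` is `-1` on the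
first and `1` on the second member of a pair, and `0` on the remaining numbers. -/
structure Pairing where
  τ : ℕ → ℕ
  η : ℕ → ℝ
  τ_τ : ∀ k, τ (τ k) = k
  η_τ : ∀ k, η (τ k) = -η k
  η_sq : ∀ k, η k = 0 ∨ η k ^ 2 = 1

namespace Pairing

variable (P : Pairing)

/-- The coefficients of an operator equal to `c` off the pairs, and to `a` plus `b` times the
rotation by `π / 2` on each pair. -/
def coeff (c a b : ℝ) : PairCoeff where
  τ := P.τ
  α k := c + P.η k ^ 2 * (a - c)
  β k := P.η k * b
  C := c ^ 2 + a ^ 2 + b ^ 2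
  τ_τ := P.τ_τ
  α_τ k := by rw [P.η_τ, neg_sq]
  β_τ k := by rw [P.η_τ, neg_mul]
  le_C k := by
    rcases P.η_sq k with h | h
    · rw [h]; nlinarith [sq_nonneg a, sq_nonneg b]
    · rw [mul_pow, h]; nlinarith [sq_nonneg c]

theorem rot_comp (θ φ : ℝ) (x : Hilb K) :
    (P.coeff 1 (Real.cos θ) (Real.sin θ)).op ((P.coeff 1 (Real.cos φ) (Real.sin φ)).op x) =
      (P.coeff 1 (Real.cos (θ + φ)) (Real.sin (θ + φ))).op x := by
  ext k
  simp only [PairCoeff.op_coord, coeff, P.τ_τ, P.η_τ, neg_sq]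
  rcases P.η_sq k with h | h
  · simp [h]
  · have h' : P.η k * P.η k = 1 := by rw [← sq, h]
    rw [h, Real.cos_add, Real.sin_add]
    match_scalars
    · linear_combination (-Real.sin θ * Real.sin φ) * h'
    · ring

theorem rot_zero (x : Hilb K) : (P.coeff 1 (Real.cos 0) (Real.sin 0)).op x = x := by
  ext k
  simp [PairCoeff.op_coord, coeff]

variable (K) in
/-- The simultaneous rotation of all pairs by the angle `θ`. -/
def rot (θ : ℝ) : UFull K :=
  mkU (P.coeff 1 (Real.cos θ) (Real.sin θ)).op (P.coeff 1 (Real.cos (-θ)) (Real.sin (-θ))).op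
    (PairCoeff.op_smul _) (fun x => by rw [rot_comp, neg_add_cancel, rot_zero])
    (fun x => by rw [rot_comp, add_neg_cancel, rot_zero]) fun x => by
      refine (sq_eq_sq₀ (norm_nonneg _) (norm_nonneg _)).1 ?_
      rw [PairCoeff.norm_sq_op, norm_sq_eq_tsum]
      refine tsum_congr fun k => ?_
      simp only [coeff]
      rcases P.η_sq k with h | h
      · simp [h]
      · rw [mul_pow, h]
        linear_combination (‖x k‖ ^ 2) * Real.cos_sq_add_sin_sq θ

theorem rot_coord (θ : ℝ) (x : Hilb K) (k : ℕ) : P.rot K θ x k =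
    (1 + P.η k ^ 2 * (Real.cos θ - 1)) • x k + (P.η k * Real.sin θ) • x (P.τ k) := rfl

theorem rot_mul (θ φ : ℝ) : P.rot K θ * P.rot K φ = P.rot K (θ + φ) :=
  LinearIsometryEquiv.ext fun x => P.rot_comp θ φ x

theorem rot_pow (θ : ℝ) (N : ℕ) : P.rot K θ ^ N = P.rot K (N * θ) := by
  induction N with
  | zero =>
    refine LinearIsometryEquiv.ext fun x => ?_
    rw [pow_zero, Nat.cast_zero, zero_mul]
    exact (P.rot_zero x).symm
  | succ N ih => rw [pow_succ, ih, rot_mul]; congr 1; push_cast; ring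

theorem norm_rot_sub_one_le (θ : ℝ) : ‖toOp K (P.rot K θ) - 1‖ ≤ |θ| := by
  refine norm_toOp_sub_one_le (abs_nonneg θ) fun x => ?_
  have h1 : P.rot K θ x - x = (P.coeff 0 (Real.cos θ - 1) (Real.sin θ)).op x := by
    ext k
    rw [sub_coord, rot_coord, PairCoeff.op_coord]
    simp only [coeff]
    module
  refine (sq_le_sq₀ (norm_nonneg _) (by positivity)).1 ?_
  rw [h1, PairCoeff.norm_sq_op, mul_pow, sq_abs, norm_sq_eq_tsum, ← tsum_mul_left]
  refine (PairCoeff.summable_coeff _ x).tsum_le_tsum (fun k => ?_)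
    ((summable_norm_sq x).mul_left _)
  refine mul_le_mul_of_nonneg_right ?_ (by positivity)
  simp only [coeff]
  rcases P.η_sq k with h | h
  · rw [h]; nlinarith [sq_nonneg θ]
  · rw [mul_pow, h]
    -- On a pair the factor is `(cos θ - 1)² + sin² θ = 2 - 2 cos θ`, which is at most `θ²`.
    have h2 := Real.one_sub_sq_div_two_le_cos (x := θ)
    nlinarith [Real.cos_sq_add_sin_sq θ]

theorem rot_e_of_eq_zero {θ : ℝ} {j : ℕ} (h : P.η j = 0) : P.rot K θ (e K j) = e K j := by
  ext k
  rw [rot_coord]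
  by_cases hk : k = j
  · simp [hk, h]
  · rw [e_coord_ne hk, smul_zero, zero_add]
    by_cases hk' : P.τ k = j
    · have : P.η k = 0 := by rw [← hk', P.η_τ, neg_eq_zero] at h; exact h
      simp [this]
    · rw [e_coord_ne hk', smul_zero]

theorem rot_pi_div_two_e {j : ℕ} (h : P.η j = -1) :
    P.rot K (Real.pi / 2) (e K j) = e K (P.τ j) := by
  have hτ : P.τ j ≠ j := by
    intro H
    have := P.η_τ j
    rw [H, h] at this
    norm_num at this
  ext k
  rw [rot_coord]
  by_cases hk : k = j
  · subst hk
    rw [e_coord_ne hτ, e_coord_ne hτ.symm, h]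
    simp
  · rw [e_coord_ne hk, smul_zero, zero_add, Real.sin_pi_div_two, mul_one]
    by_cases hk' : k = P.τ j
    · subst hk'
      simp [P.τ_τ, P.η_τ, h]
    · rw [e_coord_ne hk', e_coord_ne, smul_zero]
      rintro rfl
      exact hk' (P.τ_τ k).symm

end Pairing

/-- The pairing of consecutive blocks of length `L`, where the blocks start at `n`. -/
def blockPairing (n L : ℕ) (hL : 0 < L) : Pairing where
  τ k := if k < n then k else if (k - n) / L % 2 = 0 then k + L else k - L
  η k := if k < n then 0 else if (k - n) / L % 2 = 0 then -1 else 1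
  τ_τ k := by
    by_cases h : k < n
    · simp [h]
    obtain ⟨q, rfl⟩ := Nat.exists_eq_add_of_le (not_lt.1 h)
    by_cases hq : q / L % 2 = 0
    · have h1 : ¬ n + q + L < n := by omega
      have h2 : (n + q + L - n) / L = q / L + 1 := by
        rw [← Nat.add_div_right q hL]; congr 1; omega
      have h3 : ¬ (q / L + 1) % 2 = 0 := by omega
      simp [hq, h1, h2, h3]
    -- An odd block number forces `L ≤ q`, so the subtraction of `L` is not truncated.
    · have hLq : L ≤ q := by
        by_contra H
        exact hq (by rw [Nat.div_eq_of_lt (not_le.1 H)])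
      obtain ⟨p, rfl⟩ := Nat.exists_eq_add_of_le' hLq
      have h1 : n + (p + L) - L = n + p := by omega
      rw [Nat.add_div_right p hL] at hq
      have h3 : p / L % 2 = 0 := by omega
      have h4 : ¬ (p / L + 1) % 2 = 0 := by omega
      simp [h1, h3, h4, Nat.add_div_right p hL]
      omega
  η_τ k := by
    by_cases h : k < n
    · simp [h]
    obtain ⟨q, rfl⟩ := Nat.exists_eq_add_of_le (not_lt.1 h)
    by_cases hq : q / L % 2 = 0
    · have h1 : ¬ n + q + L < n := by omega
      have h2 : (n + q + L - n) / L = q / L + 1 := by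
        rw [← Nat.add_div_right q hL]; congr 1; omega
      have h3 : ¬ (q / L + 1) % 2 = 0 := by omega
      simp [hq, h1, h2, h3]
    · have hLq : L ≤ q := by
        by_contra H
        exact hq (by rw [Nat.div_eq_of_lt (not_le.1 H)])
      obtain ⟨p, rfl⟩ := Nat.exists_eq_add_of_le' hLq
      have h1 : n + (p + L) - L = n + p := by omega
      rw [Nat.add_div_right p hL] at hq
      have h3 : p / L % 2 = 0 := by omega
      have h4 : ¬ (p / L + 1) % 2 = 0 := by omega
      simp [h1, h3, h4, Nat.add_div_right p hL]
  η_sq k := by split_ifs <;> norm_num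

/-- The pairing of `[0, n)` with `[m, m + n)`, where `n ≤ m`. -/
def swapPairing (n m : ℕ) (h : n ≤ m) : Pairing where
  τ k := if k < n then k + m else if m ≤ k ∧ k < m + n then k - m else k
  η k := if k < n then -1 else if m ≤ k ∧ k < m + n then 1 else 0
  τ_τ k := by split_ifs <;> omega
  η_τ k := by split_ifs <;> first | omega | norm_num
  η_sq k := by split_ifs <;> norm_num

variable [FiniteDimensional ℝ K]

theorem rot_mem_preservesFinSupp {P : Pairing} {L : ℕ} (hP : ∀ k, k ≤ P.τ k + L) (θ : ℝ) :
    P.rot K θ ∈ PreservesFinSupp K := fun M => ⟨M + L, fun x hx k hk => by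
  rw [Pairing.rot_coord, hx k (by omega), hx (P.τ k) (by have := hP k; omega), smul_zero,
    smul_zero, add_zero]⟩

theorem blockPairing_rot_mem_preservesFinSupp {n L : ℕ} (hL : 0 < L) (θ : ℝ) :
    (blockPairing n L hL).rot K θ ∈ PreservesFinSupp K :=
  rot_mem_preservesFinSupp (L := L) (fun k => by
    simp only [blockPairing]; split_ifs <;> omega) θ

theorem blockPairing_rot_mem_stab {n L i : ℕ} (hL : 0 < L) (θ : ℝ) (hi : i ≤ n) :
    (blockPairing n L hL).rot K θ ∈ stab K i := fun _ hj =>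
  Pairing.rot_e_of_eq_zero _ (if_pos (hj.trans_le hi))

/-- The composition of two rotations which shifts the even blocks by two blocks. -/
theorem blockPairing_rot_shift {n L k : ℕ} (hL : 0 < L) (hk : n ≤ k)
    (he : (k - n) / L % 2 = 0) :
    ((blockPairing (n + L) L hL).rot K (Real.pi / 2) *
      (blockPairing n L hL).rot K (Real.pi / 2)) (e K k) = e K (k + 2 * L) := by
  have h1 : (blockPairing n L hL).τ k = k + L := by
    simp [blockPairing, he, not_lt.2 hk]
  have h2 : (blockPairing (n + L) L hL).τ (k + L) = k + L + L := by
    have : ¬ k + L < n + L := by omega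
    have h' : k + L - (n + L) = k - n := by omega
    simp [blockPairing, this, h', he]
  rw [UFull.mul_apply, Pairing.rot_pi_div_two_e, h1, Pairing.rot_pi_div_two_e, h2]
  · congr 1; omega
  · have : ¬ k + L < n + L := by omega
    have h' : k + L - (n + L) = k - n := by omega
    simp [blockPairing, this, h', he]
  · simp [blockPairing, he, not_lt.2 hk]

end Rotations

/-! ### Stabilizers are products of boundedly many small elements -/

section Generation

variable {K : Type} [NormedDivisionRing K] [NormedAlgebra ℝ K] [StarRing K] [StarNormSq K]
  [FiniteDimensional ℝ K]

variable (K) in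
/-- The elements of `U(∞, K)_0` fixing the first `n` basis vectors, at distance less than `ε`
from `1`. -/
def smallStab (n : ℕ) (ε : ℝ) : Set (UFull K) :=
  {g | g ∈ UInf0 K ∧ g ∈ stab K n ∧ ‖toOp K g - 1‖ < ε}

variable {n : ℕ} {ε : ℝ}

theorem one_mem_smallStab (hε : 0 < ε) : (1 : UFull K) ∈ smallStab K n ε :=
  ⟨one_mem _, one_mem _, by simpa using hε⟩

theorem conj_mem_smallStab {u g : UFull K} (hu : u ∈ PreservesFinSupp K) (hu' : u ∈ stab K n)
    (h : g ∈ smallStab K n ε) : u * g * u⁻¹ ∈ smallStab K n ε :=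
  ⟨conj_mem_UInf0 hu h.1, mul_mem (mul_mem hu' h.2.1) (inv_mem hu'), by
    rw [norm_toOp_conj_sub_one]; exact h.2.2⟩

theorem conj_mem_smallStab_pow {u g : UFull K} {N : ℕ} (hu : u ∈ PreservesFinSupp K)
    (hu' : u ∈ stab K n) (h : g ∈ smallStab K n ε ^ N) :
    u * g * u⁻¹ ∈ smallStab K n ε ^ N := by
  have h1 : MulAut.conj u g ∈ (MulAut.conj u '' smallStab K n ε) ^ N := by
    rw [← Set.image_pow]
    exact Set.mem_image_of_mem _ h
  refine Set.pow_subset_pow_left ?_ h1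
  rintro _ ⟨k, hk, rfl⟩
  exact conj_mem_smallStab hu hu' hk

/-- An element of the stabilizer is a product of small elements of the stabilizer. -/
theorem exists_list_smallStab (hε : 0 < ε) {g : UFull K} (hg : g ∈ UInf0 K)
    (hgn : g ∈ stab K n) : ∃ m, ∃ l : List (UFull K),
      (∀ a ∈ l, a ∈ smallStab K n ε ∧ a ∈ UFin K m) ∧ l.prod = g := by
  obtain ⟨m₀, hm₀⟩ := hg
  obtain ⟨m, hnm, hgm⟩ : ∃ m, n ≤ m ∧ g ∈ UFin0 K m :=
    ⟨max n m₀, le_max_left _ _, UFin0_mono (le_max_right _ _) hm₀⟩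
  have hcl := idComp_le_closure (UFin K m) (ball_mem_nhds_one hε) hgm
  rw [← Subgroup.mem_toSubmonoid, Subgroup.closure_toSubmonoid] at hcl
  obtain ⟨l, hl, hlg⟩ := Submonoid.exists_list_of_mem_closure hcl
  -- The factors of `g` found in U(m, K)_0 need not fix the first `n` basis vectors. Conjugation by
  -- `u` moves their action there to the fresh coordinates `[m, m + n)`.
  set u := (swapPairing n m hnm).rot K (Real.pi / 2) with hu
  have hu1 : ∀ j < n, u (e K j) = e K (j + m) := by
    intro j hj
    rw [hu, Pairing.rot_pi_div_two_e]
    · simp [swapPairing, hj]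
    · simp [swapPairing, hj]
  have hu2 : ∀ j, n ≤ j → j < m → u (e K j) = e K j := by
    intro j hj hj'
    refine Pairing.rot_e_of_eq_zero _ ?_
    simp [swapPairing, not_lt.2 hj, not_le.2 hj']
  have hu3 : u ∈ PreservesFinSupp K := rot_mem_preservesFinSupp (L := m) (fun k => by
    simp only [swapPairing]; split_ifs <;> omega) _
  refine ⟨m + n, l.map (MulAut.conj u), ?_, ?_⟩
  · intro b hb
    obtain ⟨a, ha, rfl⟩ := List.mem_map.1 hb
    have ha' : ‖toOp K a - 1‖ < ε ∧ a ∈ UFin0 K m := by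
      rcases hl a ha with h | h
      · exact h
      · refine ⟨?_, inv_mem_iff.1 h.2⟩
        have h1 : ‖toOp K a⁻¹ - 1‖ < ε := h.1
        rwa [norm_toOp_inv_sub_one] at h1
    have ham : a ∈ UFin K m := idComp_le _ ha'.2
    rw [MulAut.conj_apply]
    refine ⟨⟨conj_mem_UInf0 hu3 ⟨m, ha'.2⟩, fun k hk => conj_apply_e fun j => ?_, ?_⟩,
      fun k hk => conj_apply_e fun j => ?_⟩
    · rcases lt_or_ge j m with hj | hj
      · right
        rcases lt_or_ge j n with hjn | hjn
        · rw [hu1 j hjn, e_coord_ne (by omega)]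
        · rw [hu2 j hjn hj, e_coord_ne (by omega)]
      · exact Or.inl (ham j hj)
    · rw [norm_toOp_conj_sub_one]
      exact ha'.1
    · rcases lt_or_ge j m with hj | hj
      · right
        rcases lt_or_ge j n with hjn | hjn
        · rw [hu1 j hjn, e_coord_ne (by omega)]
        · rw [hu2 j hjn hj, e_coord_ne (by omega)]
      · exact Or.inl (ham j hj)
  -- The product is unchanged: `g` is supported in `[n, m)`, where `u` is the identity, so the two
  -- commute.
  · rw [← map_list_prod, hlg, MulAut.conj_apply, ← mul_comm_of_disjoint (S := {j | n ≤ j ∧ j < m})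
      (g := g), mul_assoc, mul_inv_cancel, mul_one]
    · intro j hj
      rcases lt_or_ge j n with hjn | hjn
      · exact hgn j hjn
      · exact idComp_le _ hgm j (not_lt.1 fun H => hj ⟨hjn, H⟩)
    · exact fun j hj => hu2 j hj.1 hj.2

/-- A product of small elements is a small element up to a commutator with the block shift. -/
theorem exists_eq_mul_commutator (hε : 0 < ε) {L : ℕ} (hL : 0 < L) {t : UFull K}
    (ht : t ∈ PreservesFinSupp K) (htn : t ∈ stab K n)
    (hshift : ∀ k, n ≤ k → (k - n) / L % 2 = 0 → t (e K k) = e K (k + 2 * L))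
    (l : List (UFull K)) (hl : ∀ a ∈ l, a ∈ smallStab K n ε ∧ a ∈ UFin K (n + L)) :
    ∃ D ∈ smallStab K n ε, (∀ k, ¬ (n ≤ k ∧ (k - n) / L % 2 = 0) → D (e K k) = e K k) ∧
      ∃ Q, Q ∈ UInf0 K ∧ Q ∈ stab K n ∧ l.prod = D * (Q * t * Q⁻¹ * t⁻¹) := by
  induction l with
  | nil => exact ⟨1, one_mem_smallStab hε, fun _ _ => rfl, 1, one_mem _, one_mem _, by simp⟩
  | cons a l ih =>
    obtain ⟨D, hD, hDfix, Q, hQ, hQn, hprod⟩ := ih fun b hb => hl b (List.mem_cons_of_mem a hb)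
    obtain ⟨ha, haL⟩ := hl a List.mem_cons_self
    have hg : l.prod ∈ UInf0 K :=
      list_prod_mem fun b hb => (hl b (List.mem_cons_of_mem a hb)).1.1
    have hgn : l.prod ∈ stab K n :=
      list_prod_mem fun b hb => (hl b (List.mem_cons_of_mem a hb)).1.2.1
    have hgL : l.prod ∈ UFin K (n + L) :=
      list_prod_mem fun b hb => (hl b (List.mem_cons_of_mem a hb)).2
    set g := l.prod with hgdef
    -- `D` lives on the even blocks, which `t` shifts by two. Thus `D'` lives on the even blocks
    -- beyond the first one and its support is disjoint from that of `a` and of `g`.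
    set D' := t * D * t⁻¹ with hD'
    have hD'mem : D' ∈ smallStab K n ε := conj_mem_smallStab ht htn hD
    have hD'fix : ∀ k, (∀ j, n ≤ j → (j - n) / L % 2 = 0 → k ≠ j + 2 * L) →
        D' (e K k) = e K k := by
      intro k hk
      refine conj_apply_e fun j => ?_
      by_cases hj : n ≤ j ∧ (j - n) / L % 2 = 0
      · exact Or.inr (by rw [hshift j hj.1 hj.2, e_coord_ne (hk j hj.1 hj.2)])
      · exact Or.inl (hDfix j hj)
    have hout : ∀ {b : UFull K}, b ∈ stab K n → b ∈ UFin K (n + L) →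
        ∀ j ∉ {j | n ≤ j ∧ j < n + L}, b (e K j) = e K j := by
      intro b hb hb' j hj
      rcases lt_or_ge j n with hjn | hjn
      · exact hb j hjn
      · exact hb' j (not_lt.1 fun H => hj ⟨hjn, H⟩)
    have hin : ∀ j ∈ {j | n ≤ j ∧ j < n + L}, D' (e K j) = e K j := by
      rintro j ⟨-, hj⟩
      exact hD'fix j fun i hi _ => by omega
    -- For a list `a₁, a₂, a₃, ...` this recursion produces `D = a₁ (t a₂ t⁻¹) (t² a₃ t⁻²) ⋯`, whose
    -- factors have disjoint supports, so its distance from `1` stays below `ε` for any number of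
    -- factors.
    refine ⟨a * D', ⟨mul_mem ha.1 hD'mem.1, mul_mem ha.2.1 hD'mem.2.1, ?_⟩, ?_, g * (t * Q * t⁻¹),
      mul_mem hg (conj_mem_UInf0 ht hQ), mul_mem hgn (mul_mem (mul_mem htn hQn) (inv_mem htn)), ?_⟩
    · exact (norm_toOp_mul_sub_one_le_of_disjoint (hout ha.2.1 haL) hin (le_max_left _ _)
        (le_max_right _ _)).trans_lt (max_lt ha.2.2 hD'mem.2.2)
    · intro k hk
      have h1 : D' (e K k) = e K k := by
        refine hD'fix k fun j hj hj' hkj => hk ⟨by omega, ?_⟩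
        have : k - n = j - n + 2 * L := by omega
        rw [this, Nat.add_mul_div_right _ _ hL]
        omega
      rw [UFull.mul_apply, h1]
      refine hout ha.2.1 haL k fun H => hk ⟨H.1, ?_⟩
      have h2 := H.2
      rw [Nat.div_eq_of_lt (by omega)]
    · have hcomm : D' * g = g * D' := (mul_comm_of_disjoint (hout hgn hgL) hin).symm
      have h1 : Q * t * Q⁻¹ * t⁻¹ = D⁻¹ * g := by rw [hprod, inv_mul_cancel_left]
      rw [List.prod_cons]
      calc a * g = a * (D' * g * D'⁻¹) := by rw [hcomm, mul_inv_cancel_right]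
        _ = a * D' * g * (t * (D⁻¹ * g) * g⁻¹ * t⁻¹) := by rw [hD']; group
        _ = a * D' * (g * (t * Q * t⁻¹) * t * (g * (t * Q * t⁻¹))⁻¹ * t⁻¹) := by
          rw [← h1]; group

/-- The commutator with the `N`-th power of a small element is a product of `N` small elements. -/
theorem commutator_pow_mem {r Q : UFull K} (hr : r ∈ PreservesFinSupp K) (hrn : r ∈ stab K n)
    (hrε : 2 * ‖toOp K r - 1‖ < ε) (hQ : Q ∈ UInf0 K) (hQn : Q ∈ stab K n) (N : ℕ) :
    Q * r ^ N * Q⁻¹ * (r ^ N)⁻¹ ∈ smallStab K n ε ^ N := by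
  have h1 : Q * r * Q⁻¹ * r⁻¹ ∈ smallStab K n ε := by
    refine ⟨?_, mul_mem (mul_mem (mul_mem hQn hrn) (inv_mem hQn)) (inv_mem hrn), ?_⟩
    -- `r` need not lie in `UInf0 K`, but the commutator is `Q` times the conjugate of `Q⁻¹` by `r`.
    · have := mul_mem hQ (conj_mem_UInf0 hr (inv_mem hQ))
      simpa only [mul_assoc] using this
    · have := norm_toOp_mul_sub_one_le (Q * r * Q⁻¹) r⁻¹
      rw [norm_toOp_conj_sub_one, norm_toOp_inv_sub_one] at this
      linarith
  induction N with
  | zero => simp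
  | succ N ih =>
    -- The rule `[Q, ab] = [Q, a] · a [Q, b] a⁻¹` with `a = r ^ N` and `b = r`; conjugating by
    -- powers of `r` preserves smallness.
    have h2 : Q * r ^ (N + 1) * Q⁻¹ * (r ^ (N + 1))⁻¹ =
        (Q * r ^ N * Q⁻¹ * (r ^ N)⁻¹) * (r ^ N * (Q * r * Q⁻¹ * r⁻¹) * (r ^ N)⁻¹) := by
      rw [pow_succ]; group
    rw [h2, pow_succ]
    exact Set.mul_mem_mul ih (conj_mem_smallStab (pow_mem hr N) (pow_mem hrn N) h1)

/-- Every element of the stabilizer of the first `n` basis vectors is a product of `N` elements of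
the stabilizer at distance less than `ε` from `1`, with `N` depending on `ε` only. -/
theorem exists_uniform_pow (K : Type) [NormedDivisionRing K] [NormedAlgebra ℝ K] [StarRing K]
    [StarNormSq K] [FiniteDimensional ℝ K] {ε : ℝ} (hε : 0 < ε) :
    ∃ N : ℕ, ∀ n, ∀ g ∈ UInf0 K, g ∈ stab K n → g ∈ smallStab K n ε ^ N := by
  -- A commutator with a rotation by `θ = π / (2N)` is within `2 |θ| = π / N < ε` of `1`.
  obtain ⟨N, hN⟩ := exists_nat_gt (Real.pi / ε)
  have hN0 : (0 : ℝ) < N := (div_pos Real.pi_pos hε).trans hN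
  -- One factor for `D`, and `N` for each of the two quarter turns composing the shift.
  refine ⟨1 + (N + N), fun n g hg hgn => ?_⟩
  obtain ⟨m, l, hl, rfl⟩ := exists_list_smallStab hε hg hgn
  obtain ⟨L, hL, hmL⟩ : ∃ L, 0 < L ∧ m ≤ n + L := ⟨m + 1, by omega, by omega⟩
  set θ : ℝ := Real.pi / 2 / N with hθ
  have hθN : N * θ = Real.pi / 2 := by rw [hθ]; field_simp
  have hθε : 2 * |θ| < ε := by
    rw [abs_of_pos (by positivity), hθ]
    rw [div_lt_iff₀ hε] at hN
    have : 2 * (Real.pi / 2 / N) = Real.pi / N := by ring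
    rw [this, div_lt_iff₀ hN0]
    linarith
  set r₁ := (blockPairing (n + L) L hL).rot K θ with hr₁
  set r₂ := (blockPairing n L hL).rot K θ with hr₂
  have hr₁f : r₁ ∈ PreservesFinSupp K := blockPairing_rot_mem_preservesFinSupp hL θ
  have hr₂f : r₂ ∈ PreservesFinSupp K := blockPairing_rot_mem_preservesFinSupp hL θ
  have hr₁n : r₁ ∈ stab K n := blockPairing_rot_mem_stab hL θ (by omega)
  have hr₂n : r₂ ∈ stab K n := blockPairing_rot_mem_stab hL θ le_rfl
  have hr₁ε : 2 * ‖toOp K r₁ - 1‖ < ε := by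
    have := (blockPairing (n + L) L hL).norm_rot_sub_one_le (K := K) θ
    linarith
  have hr₂ε : 2 * ‖toOp K r₂ - 1‖ < ε := by
    have := (blockPairing n L hL).norm_rot_sub_one_le (K := K) θ
    linarith
  obtain ⟨D, hD, -, Q, hQ, hQn, hprod⟩ := exists_eq_mul_commutator hε hL (t := r₁ ^ N * r₂ ^ N)
    (mul_mem (pow_mem hr₁f N) (pow_mem hr₂f N)) (mul_mem (pow_mem hr₁n N) (pow_mem hr₂n N))
    (fun k hk hk' => by
      rw [hr₁, hr₂, Pairing.rot_pow, Pairing.rot_pow, hθN]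
      exact blockPairing_rot_shift hL hk hk') l
    (fun a ha => ⟨(hl a ha).1, fun j hj => (hl a ha).2 j (hmL.trans hj)⟩)
  have hsplit : Q * (r₁ ^ N * r₂ ^ N) * Q⁻¹ * (r₁ ^ N * r₂ ^ N)⁻¹ =
      (Q * r₁ ^ N * Q⁻¹ * (r₁ ^ N)⁻¹) *
        (r₁ ^ N * (Q * r₂ ^ N * Q⁻¹ * (r₂ ^ N)⁻¹) * (r₁ ^ N)⁻¹) := by group
  rw [hprod, hsplit, pow_add, pow_add, pow_one]
  exact Set.mul_mem_mul hD (Set.mul_mem_mul (commutator_pow_mem hr₁f hr₁n hr₁ε hQ hQn N)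
    (conj_mem_smallStab_pow (pow_mem hr₁f N) (pow_mem hr₁n N)
      (commutator_pow_mem hr₂f hr₂n hr₂ε hQ hQn N)))

end Generation

/-! ### Norm-continuous representations are tame -/

section FixedVectors

variable {V : Type*} [NormedAddCommGroup V] [InnerProductSpace ℂ V]

/-- The parallelogram law: two vectors of equal norm whose midpoint is hardly shorter are close. It
serves below both for exact minimizers of the norm (`c = ‖x‖`) and for approximate ones. -/
theorem norm_sub_sq_le_of_le_midpoint {x y : V} {c : ℝ} (hc : 0 ≤ c) (hxy : ‖y‖ = ‖x‖)
    (h : c ≤ ‖(1 / 2 : ℝ) • x + (1 / 2 : ℝ) • y‖) : ‖y - x‖ ^ 2 ≤ 4 * (‖x‖ ^ 2 - c ^ 2) := by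
  have h1 := parallelogram_law_with_norm ℂ x y
  rw [← smul_add, norm_smul, Real.norm_of_nonneg (by norm_num)] at h
  rw [norm_sub_rev x y, hxy] at h1
  nlinarith [norm_nonneg (x + y)]

theorem map_mem_convexHull (u : V ≃ₗᵢ[ℂ] V) {s t : Set V} (h : ∀ y ∈ s, u y ∈ t) {x : V}
    (hx : x ∈ convexHull ℝ s) : u x ∈ convexHull ℝ t := by
  have h1 : (u.toLinearEquiv.toLinearMap.restrictScalars ℝ) x ∈
      convexHull ℝ ((u.toLinearEquiv.toLinearMap.restrictScalars ℝ) '' s) := by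
    rw [← LinearMap.image_convexHull]
    exact Set.mem_image_of_mem _ hx
  refine convexHull_mono ?_ h1
  rintro _ ⟨y, hy, rfl⟩
  exact h y hy

/-- A vector which is moved only a little by a group of unitary operators is close to a fixed
vector. -/
theorem exists_fixed_of_norm_sub_le [CompleteSpace V] {G : Type*} [Group G]
    (π : G →* (V ≃ₗᵢ[ℂ] V)) (H : Subgroup G) {x : V} {δ : ℝ}
    (h : ∀ g ∈ H, ‖π g x - x‖ ≤ δ) : ∃ w, ‖w - x‖ ≤ δ ∧ ∀ g ∈ H, π g w = w := by
  set s : Set V := {y | ∃ g ∈ H, π g x = y} with hs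
  set C : Set V := closure (convexHull ℝ s) with hC
  have hconv : Convex ℝ C := (convex_convexHull ℝ s).closure
  have hne : C.Nonempty := ⟨π 1 x, subset_closure (subset_convexHull ℝ s ⟨1, one_mem H, rfl⟩)⟩
  have hball : C ⊆ Metric.closedBall x δ := by
    refine closure_minimal (convexHull_min ?_ (convex_closedBall x δ)) Metric.isClosed_closedBall
    rintro _ ⟨g, hg, rfl⟩
    rw [Metric.mem_closedBall, dist_eq_norm]
    exact h g hg
  let : InnerProductSpace ℝ V := InnerProductSpace.rclikeToReal ℂ V
  -- `w` is the element of least norm in the invariant set `C`. Its image under `π g` has the same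
  -- norm and the midpoint lies in `C`, so the two coincide.
  obtain ⟨w, hw, hmin⟩ := exists_norm_eq_iInf_of_complete_convex hne
    isClosed_closure.isComplete hconv 0
  have hle : ∀ y ∈ C, ‖w‖ ≤ ‖y‖ := by
    intro y hy
    have h1 : (⨅ z : C, ‖(0 : V) - z‖) ≤ ‖(0 : V) - y‖ :=
      ciInf_le ⟨0, by rintro _ ⟨z, rfl⟩; exact norm_nonneg _⟩ (⟨y, hy⟩ : C)
    rw [← hmin, zero_sub, zero_sub, norm_neg, norm_neg] at h1
    exact h1
  refine ⟨w, ?_, fun g hg => ?_⟩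
  · have := hball hw
    rwa [Metric.mem_closedBall, dist_eq_norm] at this
  · have hgw : π g w ∈ C := by
      refine map_mem_closure (π g).continuous hw fun y hy => ?_
      refine map_mem_convexHull (π g) ?_ hy
      rintro _ ⟨k, hk, rfl⟩
      exact ⟨g * k, mul_mem hg hk, by rw [map_mul]; rfl⟩
    have h1 := norm_sub_sq_le_of_le_midpoint (norm_nonneg w) ((π g).norm_map w)
      (hle _ (hconv hw hgw (by norm_num) (by norm_num) (by norm_num)))
    rw [sub_self, mul_zero] at h1
    have h2 : ‖π g w - w‖ = 0 := by
      have := sq_nonneg ‖π g w - w‖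
      exact pow_eq_zero_iff (two_ne_zero) |>.1 (le_antisymm h1 this)
    exact sub_eq_zero.1 (norm_eq_zero.1 h2)

end FixedVectors

/-! ### From norm continuity to fixed vectors -/

section NormContinuous

variable {K : Type} [NormedDivisionRing K] [NormedAlgebra ℝ K]
variable {V : Type*} [NormedAddCommGroup V] [InnerProductSpace ℂ V]

/-- Continuity of a unitary representation of `U(∞, K)_0` for the topology of the operator norm. -/
def IsNormContinuous (π : UInf0 K →* (V ≃ₗᵢ[ℂ] V)) : Prop :=
  ∀ v : V, ∀ δ > 0, ∃ ε > 0, ∀ g : UInf0 K, ‖toOp K g - 1‖ < ε → ‖π g v - v‖ < δ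

theorem isNormContinuous_of_extendsContinuously [FiniteDimensional ℝ K]
    {π : UInf0 K →* (V ≃ₗᵢ[ℂ] V)} (h : ExtendsContinuously π) : IsNormContinuous π := by
  obtain ⟨ρ, hρ, rfl⟩ := h
  intro v δ hδ
  have h1 : (fun g : UCompact0 K => ρ g v) ⁻¹' Metric.ball v δ ∈ 𝓝 (1 : UCompact0 K) := by
    refine (hρ v).continuousAt.preimage_mem_nhds ?_
    simpa using Metric.ball_mem_nhds v hδ
  rw [nhds_subtype_eq_comap, Filter.mem_comap] at h1
  obtain ⟨s, hs, hs'⟩ := h1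
  obtain ⟨ε, hε, hεs⟩ := mem_nhds_one_iff.1 hs
  refine ⟨ε, hε, fun g hg => ?_⟩
  have := hs' (a := Subgroup.inclusion UInf0_le_UCompact0 g) (hεs g hg)
  rwa [Set.mem_preimage, Metric.mem_ball, dist_eq_norm] at this

variable [StarRing K] [StarNormSq K] [FiniteDimensional ℝ K]

/-- Norm-continuity yields vectors close to `v` that are almost fixed by small elements far out. -/
theorem IsNormContinuous.exists_almost_fixed_small {π : UInf0 K →* (V ≃ₗᵢ[ℂ] V)}
    (v : V) {ε δ η : ℝ} (hε : 0 < ε) (hη : 0 < η)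
    (hv : ∀ g : UInf0 K, ‖toOp K g - 1‖ < ε → ‖π g v - v‖ ≤ δ) :
    ∃ x m, ‖x - v‖ ≤ δ ∧
      ∀ g : UInf0 K, (g : UFull K) ∈ smallStab K m ε → ‖π g x - x‖ ≤ 2 * η := by
  set s : ℕ → Set V := fun m =>
    {y | ∃ g : UInf0 K, ‖toOp K g - 1‖ < ε ∧ (g : UFull K) ∈ UFin K m ∧ π g v = y} with hs
  set N : Set ℝ := {r | ∃ m, ∃ y ∈ convexHull ℝ (s m), ‖y‖ = r} with hN
  have hsmono : ∀ {m m'}, m ≤ m' → s m ⊆ s m' := by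
    rintro m m' h _ ⟨g, hg, hgm, rfl⟩
    exact ⟨g, hg, fun j hj => hgm j (h.trans hj), rfl⟩
  have hN0 : N.Nonempty := ⟨_, 0, π 1 v, subset_convexHull ℝ _
    ⟨1, by simpa using hε, one_mem _, rfl⟩, rfl⟩
  have hNb : BddBelow N := ⟨0, by rintro _ ⟨m, y, -, rfl⟩; exact norm_nonneg y⟩
  have hc : 0 ≤ sInf N := Real.sInf_nonneg (by rintro _ ⟨m, y, -, rfl⟩; exact norm_nonneg y)
  set c := sInf N with hcdef
  -- With `‖x‖² < c² + η²` the parallelogram estimate yields `‖π g x - x‖² ≤ 4 η²`.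
  have hlt : c < √(c ^ 2 + η ^ 2) := by
    rw [Real.lt_sqrt hc]
    have := pow_pos hη 2
    linarith
  obtain ⟨_, ⟨m, x, hx, rfl⟩, hxc⟩ := exists_lt_of_csInf_lt hN0 hlt
  rw [Real.lt_sqrt (norm_nonneg _)] at hxc
  refine ⟨x, m, ?_, fun g hg => ?_⟩
  · have : convexHull ℝ (s m) ⊆ Metric.closedBall v δ := by
      refine convexHull_min ?_ (convex_closedBall v δ)
      rintro _ ⟨g, hg, -, rfl⟩
      rw [Metric.mem_closedBall, dist_eq_norm]
      exact hv g hg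
    have := this hx
    rwa [Metric.mem_closedBall, dist_eq_norm] at this
  · obtain ⟨⟨m₁, hm₁⟩, hgm, hgε⟩ := hg
    obtain ⟨m', hmm', hgm'⟩ : ∃ m', m ≤ m' ∧ (g : UFull K) ∈ UFin K m' :=
      ⟨max m m₁, le_max_left _ _, fun j hj => idComp_le _ hm₁ j ((le_max_right _ _).trans hj)⟩
    have h1 : π g x ∈ convexHull ℝ (s m') := by
      refine map_mem_convexHull (π g) ?_ hx
      rintro _ ⟨k, hk, hkm, rfl⟩
      refine ⟨g * k, ?_, mul_mem hgm' fun j hj => hkm j (hmm'.trans hj), by rw [map_mul]; rfl⟩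
      -- `g` acts on coordinates from `m` on and `k` on those below `m`, so the distance of `g * k`
      -- from `1` is bounded by a maximum, not by a sum, and stays below `ε`.
      exact (norm_toOp_mul_sub_one_le_of_disjoint (S := {j | m ≤ j})
        (fun j hj => hgm j (not_le.1 hj)) hkm (le_max_left _ _)
        (le_max_right _ _)).trans_lt (max_lt hgε hk)
    have h2 : c ≤ ‖(1 / 2 : ℝ) • x + (1 / 2 : ℝ) • π g x‖ :=
      csInf_le hNb ⟨m', _, convex_convexHull ℝ (s m') (convexHull_mono (hsmono hmm') hx) h1
        (by norm_num) (by norm_num) (by norm_num), rfl⟩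
    have h3 := norm_sub_sq_le_of_le_midpoint hc ((π g).norm_map x) h2
    refine (sq_le_sq₀ (norm_nonneg _) (by positivity)).1 ?_
    nlinarith

theorem norm_map_sub_le_of_mem_pow {π : UInf0 K →* (V ≃ₗᵢ[ℂ] V)} {x : V} {m : ℕ} {ε η : ℝ}
    (h : ∀ g : UInf0 K, (g : UFull K) ∈ smallStab K m ε → ‖π g x - x‖ ≤ η) (N : ℕ) :
    ∀ g : UInf0 K, (g : UFull K) ∈ smallStab K m ε ^ N → ‖π g x - x‖ ≤ N * η := by
  induction N with
  | zero =>
    intro g hg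
    have : g = 1 := Subtype.ext (by simpa using hg)
    simp [this]
  | succ N ih =>
    intro g hg
    rw [pow_succ, Set.mem_mul] at hg
    obtain ⟨a, ha, b, hb, hab⟩ := hg
    have haU : a ∈ UInf0 K := by
      have : a = (g : UFull K) * b⁻¹ := by rw [← hab, mul_inv_cancel_right]
      rw [this]
      exact mul_mem g.2 (inv_mem hb.1)
    have hg' : g = ⟨a, haU⟩ * ⟨b, hb.1⟩ := Subtype.ext hab.symm
    have h1 : π g x - x = π ⟨a, haU⟩ (π ⟨b, hb.1⟩ x - x) + (π ⟨a, haU⟩ x - x) := by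
      rw [hg', map_mul, map_sub, sub_add_sub_cancel]; rfl
    have h2 := norm_add_le (π ⟨a, haU⟩ (π ⟨b, hb.1⟩ x - x)) (π ⟨a, haU⟩ x - x)
    rw [LinearIsometryEquiv.norm_map, ← h1] at h2
    have h3 := ih ⟨a, haU⟩ ha
    have h4 := h ⟨b, hb.1⟩ hb
    push_cast
    linarith

theorem IsNormContinuous.isTame [CompleteSpace V] {π : UInf0 K →* (V ≃ₗᵢ[ℂ] V)}
    (hπ : IsNormContinuous π) : IsTame π := by
  refine Metric.dense_iff.2 fun v δ hδ => ?_
  obtain ⟨ε, hε, hv⟩ := hπ v (δ / 3) (by positivity)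
  -- It is essential that `N` is known before `m`: the tolerance for `x` is chosen in terms of `N`,
  -- and `m` depends on that tolerance.
  obtain ⟨N, hN⟩ := exists_uniform_pow K hε
  obtain ⟨x, m, hxv, hx⟩ := IsNormContinuous.exists_almost_fixed_small (π := π) v hε
    (η := δ / 6 / (N + 1)) (by positivity) fun g hg => (hv g hg).le
  have h1 : ∀ g ∈ (stab K m).subgroupOf (UInf0 K), ‖π g x - x‖ ≤ δ / 3 := by
    intro g hg
    refine (norm_map_sub_le_of_mem_pow hx N g (hN m g g.2 hg)).trans ?_
    have : (N : ℝ) * (2 * (δ / 6 / (N + 1))) = N / (N + 1) * (δ / 3) := by field_simp; ring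
    rw [this]
    refine mul_le_of_le_one_left (by positivity) ?_
    rw [div_le_one (by positivity)]
    linarith
  obtain ⟨w, hw, hwfix⟩ := exists_fixed_of_norm_sub_le π _ h1
  refine ⟨w, ?_, Set.mem_iUnion.2 ⟨m, hwfix⟩⟩
  rw [Metric.mem_ball, dist_eq_norm]
  have := norm_sub_le_norm_sub_add_norm_sub w x v
  linarith

end NormContinuous

/-! ### Rotations in a plane -/

section PlaneRotations

variable {K : Type} [NormedDivisionRing K] [NormedAlgebra ℝ K]

variable (K) in
/-- Scalar multiplication as a continuous real-bilinear map. -/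
def smulL : K →L[ℝ] Hilb K →L[ℝ] Hilb K :=
  LinearMap.mkContinuous₂ (LinearMap.mk₂ ℝ (fun (a : K) (x : Hilb K) => a • x) add_smul
    (fun r a x => by
      ext j
      simp) smul_add fun r a x => smul_real_smul a r x) 1 fun a x => by
      rw [one_mul]; exact norm_smul_le a x

variable [StarRing K] [StarNormSq K] [FiniteDimensional ℝ K]

theorem add_self_ne_zero {x : Hilb K} (hx : ‖x‖ = 1) : x + x ≠ 0 := by
  rw [← two_smul ℝ x]
  exact smul_ne_zero two_ne_zero (norm_ne_zero_iff.1 (by rw [hx]; exact one_ne_zero))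

/-- The operator `z ↦ z - ⟨z, u⟩ c u`. -/
def reflOp (u : Hilb K) (c : K) : Hilb K →L[ℝ] Hilb K :=
  1 - ((smulL K).flip u).comp (((ContinuousLinearMap.mul ℝ K).flip c).comp (formL.flip u))

theorem reflOp_apply (u : Hilb K) (c : K) (z : Hilb K) :
    reflOp u c z = z - (form z u * c) • u := rfl

theorem continuous_reflOp : Continuous fun p : Hilb K × K => reflOp p.1 p.2 := by
  unfold reflOp
  fun_prop

theorem reflOp_smul (u : Hilb K) (c a : K) (z : Hilb K) :
    reflOp u c (a • z) = a • reflOp u c z := by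
  rw [reflOp_apply, reflOp_apply, form_smul_left, smul_sub, smul_smul, mul_assoc]

/-- In the composite, the coefficient along `u` is `star c + c - star c * ‖u‖² * c`, up to the left
factor `form z u`. The condition on `c` says that it vanishes. -/
theorem reflOp_reflOp_star {u : Hilb K} {c : K}
    (h : c + star c = algebraMap ℝ K (‖u‖ ^ 2 * ‖c‖ ^ 2)) (z : Hilb K) :
    reflOp u c (reflOp u (star c) z) = z := by
  have h1 : star c * algebraMap ℝ K (‖u‖ ^ 2) * c = c + star c := by
    rw [h, ← Algebra.commutes, mul_assoc, star_mul_self', map_mul]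
  rw [reflOp_apply, reflOp_apply, form_sub_left, form_smul_left, form_self, sub_mul, sub_sub,
    ← add_smul, mul_assoc (form z u), mul_assoc (form z u), h1]
  have h2 : form z u * star c + (form z u * c - form z u * (c + star c)) = 0 := by
    rw [mul_add]; abel
  rw [h2, zero_smul, sub_zero]

theorem norm_reflOp {u : Hilb K} {c : K}
    (h : c + star c = algebraMap ℝ K (‖u‖ ^ 2 * ‖c‖ ^ 2)) (z : Hilb K) : ‖reflOp u c z‖ = ‖z‖ := by
  have h1 : c * algebraMap ℝ K (‖u‖ ^ 2) * star c = c + star c := by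
    rw [h, ← Algebra.commutes, mul_assoc, mul_star_self', map_mul]
  have h2 : form (reflOp u c z) (reflOp u c z) = form z z := by
    rw [reflOp_apply, form_sub_left, form_sub_right, form_sub_right, form_smul_left,
      form_smul_left, form_smul_right, form_smul_right, form_self u, star_mul, star_form]
    have h3 : form z u * c * (algebraMap ℝ K (‖u‖ ^ 2) * (star c * form u z)) =
        form z u * (c * algebraMap ℝ K (‖u‖ ^ 2) * star c) * form u z := by
      simp only [mul_assoc]
    rw [h3, h1, mul_add, add_mul]
    simp only [mul_assoc]
    abel
  rw [form_self, form_self] at h2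
  exact (sq_eq_sq₀ (norm_nonneg _) (norm_nonneg _)).1 ((algebraMap ℝ K).injective h2)

/-- The unitary quasi-reflection `z ↦ z - ⟨z, u⟩ c u`. -/
def refl (u : Hilb K) (c : K) (h : c + star c = algebraMap ℝ K (‖u‖ ^ 2 * ‖c‖ ^ 2)) : UFull K :=
  mkU (reflOp u c) (reflOp u (star c)) (reflOp_smul u c)
    (fun z => by
      have h' : star c + star (star c) = algebraMap ℝ K (‖u‖ ^ 2 * ‖star c‖ ^ 2) := by
        rw [star_star, norm_star', add_comm, h]
      have := reflOp_reflOp_star h' z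
      rwa [star_star] at this)
    (reflOp_reflOp_star h) (norm_reflOp h)

/-- The coefficient of the second quasi-reflection in a plane rotation. -/
def rotCoeff (x y : Hilb K) : K := (‖1 + form x y‖ ^ 2)⁻¹ • star (1 + form x y)

/-- The operator underlying the rotation which maps the unit vector `x` to the unit vector `y`. -/
def planeRotOp (x y : Hilb K) : Hilb K →L[ℝ] Hilb K :=
  (reflOp (x + y) (rotCoeff x y)).comp (reflOp x 2)

theorem one_add_form_add_star {x y : Hilb K} (hx : ‖x‖ = 1) (hy : ‖y‖ = 1) :
    (1 + form x y) + star (1 + form x y) = algebraMap ℝ K (‖x + y‖ ^ 2) := by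
  rw [← form_self, form_add_left, form_add_right, form_add_right, form_self_of_norm_one hx,
    form_self_of_norm_one hy, star_add, star_one, star_form]
  abel

theorem one_add_form_ne_zero {x y : Hilb K} (hx : ‖x‖ = 1) (hy : ‖y‖ = 1) (hxy : x + y ≠ 0) :
    1 + form x y ≠ 0 := by
  intro h
  have h1 := one_add_form_add_star hx hy
  rw [h, star_zero, add_zero] at h1
  have h2 := (algebraMap ℝ K).injective ((map_zero _).trans h1)
  exact hxy (by simpa using h2.symm)

theorem one_add_form_mul_rotCoeff {x y : Hilb K} (h : 1 + form x y ≠ 0) :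
    (1 + form x y) * rotCoeff x y = 1 := by
  rw [rotCoeff, mul_smul_comm, mul_star_self', Algebra.algebraMap_eq_smul_one, smul_smul,
    inv_mul_cancel₀ (by simpa using h), one_smul]

/-- `rotCoeff x y` is the inverse of `s = 1 + form x y`, and `s + star s = ‖x + y‖²`; dividing by
`‖s‖²` gives the unitarity condition for the quasi-reflection along `x + y`. -/
theorem rotCoeff_spec {x y : Hilb K} (hx : ‖x‖ = 1) (hy : ‖y‖ = 1) (hxy : x + y ≠ 0) :
    rotCoeff x y + star (rotCoeff x y) =
      algebraMap ℝ K (‖x + y‖ ^ 2 * ‖rotCoeff x y‖ ^ 2) := by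
  have h := norm_ne_zero_iff.2 (one_add_form_ne_zero hx hy hxy)
  have h1 : ‖rotCoeff x y‖ = ‖1 + form x y‖⁻¹ := by
    rw [rotCoeff, norm_smul, norm_star', norm_inv, norm_pow, norm_norm]
    field_simp
  rw [h1, rotCoeff, star_real_smul, star_star, ← smul_add, add_comm (star _),
    one_add_form_add_star hx hy, Algebra.smul_def, ← map_mul]
  congr 1
  rw [inv_pow, mul_comm]

theorem two_spec {x : Hilb K} (hx : ‖x‖ = 1) :
    (2 : K) + star 2 = algebraMap ℝ K (‖x‖ ^ 2 * ‖(2 : K)‖ ^ 2) := by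
  have h2 : (2 : K) = algebraMap ℝ K 2 := (map_ofNat _ 2).symm
  rw [h2, star_algebraMap, norm_algebraMap', hx, ← map_add]
  norm_num

open Classical in
/-- The unitary operator in the span of the unit vectors `x` and `y ≠ -x` which maps `x` to `y`. -/
def planeRot (x y : Hilb K) : UFull K :=
  if h : ‖x‖ = 1 ∧ ‖y‖ = 1 ∧ x + y ≠ 0 then
    refl (x + y) (rotCoeff x y) (rotCoeff_spec h.1 h.2.1 h.2.2) * refl x 2 (two_spec h.1)
  else 1

theorem toOp_planeRot {x y : Hilb K} (hx : ‖x‖ = 1) (hy : ‖y‖ = 1) (hxy : x + y ≠ 0) :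
    toOp K (planeRot x y) = planeRotOp x y := by
  rw [planeRot, dif_pos ⟨hx, hy, hxy⟩]
  rfl

theorem planeRot_eq {x y : Hilb K} (hx : ‖x‖ = 1) (hy : ‖y‖ = 1) (hxy : x + y ≠ 0)
    (z : Hilb K) : planeRot x y z =
    reflOp (x + y) (rotCoeff x y) (reflOp x 2 z) := by
  rw [← toOp_apply, toOp_planeRot hx hy hxy]
  rfl

/-- The reflection along `x` sends `x` to `-x`, and the coefficient of the second factor is chosen
so that it sends `-x` to `y`. -/
theorem planeRot_apply_self {x y : Hilb K} (hx : ‖x‖ = 1) (hy : ‖y‖ = 1) (hxy : x + y ≠ 0) :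
    planeRot x y x = y := by
  rw [planeRot_eq hx hy hxy]
  have h1 : reflOp x 2 x = -x := by
    rw [reflOp_apply, form_self_of_norm_one hx, one_mul, two_smul]; abel
  rw [h1, reflOp_apply, form_neg_left, form_add_right, form_self_of_norm_one hx, neg_mul,
    one_add_form_mul_rotCoeff (one_add_form_ne_zero hx hy hxy), neg_smul, one_smul]
  abel

theorem planeRot_apply_of_orthogonal {x y : Hilb K} (hx : ‖x‖ = 1) (hy : ‖y‖ = 1) (hxy : x + y ≠ 0)
    {z : Hilb K} (h1 : form z x = 0) (h2 : form z y = 0) :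
    planeRot x y z = z := by
  rw [planeRot_eq hx hy hxy]
  have h3 : reflOp x 2 z = z := by rw [reflOp_apply, h1, zero_mul, zero_smul, sub_zero]
  rw [h3, reflOp_apply, form_add_right, h1, h2, add_zero, zero_mul, zero_smul, sub_zero]

theorem planeRot_apply_e {x y : Hilb K} (hx : ‖x‖ = 1) (hy : ‖y‖ = 1) (hxy : x + y ≠ 0)
    {j : ℕ} (h1 : x j = 0) (h2 : y j = 0) :
    planeRot x y (e K j) = e K j :=
  planeRot_apply_of_orthogonal hx hy hxy (by rw [form_e_left, h1, star_zero])
    (by rw [form_e_left, h2, star_zero])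

/-- The construction involves only `x`, `y` and the form, which unitary operators preserve. This
allows rotations towards vectors of long support to be carried into a fixed finite block. -/
theorem conj_planeRot {x y : Hilb K} (hx : ‖x‖ = 1) (hy : ‖y‖ = 1) (hxy : x + y ≠ 0)
    (u : UFull K) : u * planeRot x y * u⁻¹ = planeRot (u x) (u y) := by
  have hx' : ‖u x‖ = 1 := by rw [LinearIsometryEquiv.norm_map, hx]
  have hy' : ‖u y‖ = 1 := by rw [LinearIsometryEquiv.norm_map, hy]
  have hxy' : u x + u y ≠ 0 := by
    rw [← map_add]
    exact fun h => hxy (u.map_eq_zero_iff.1 h)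
  have key : ∀ (w : Hilb K) (c : K) (z : Hilb K), u (reflOp w c z) = reflOp (u w) c (u z) := by
    intro w c z
    rw [reflOp_apply, reflOp_apply, map_sub, map_smul, form_map]
  have hc : rotCoeff (u x) (u y) = rotCoeff x y := by rw [rotCoeff, rotCoeff, form_map]
  refine LinearIsometryEquiv.ext fun z => ?_
  rw [UFull.mul_apply, UFull.mul_apply, planeRot_eq hx hy hxy, planeRot_eq hx' hy' hxy', key, key,
    UFull.apply_inv_self, map_add, hc]

theorem continuousAt_planeRotOp {x y : Hilb K} (hx : ‖x‖ = 1) (hy : ‖y‖ = 1) (hxy : x + y ≠ 0) :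
    ContinuousAt (planeRotOp x) y := by
  have h0 : ‖1 + form x y‖ ^ 2 ≠ 0 := by
    simpa using one_add_form_ne_zero hx hy hxy
  have hf : Continuous fun w : Hilb K => form x w :=
    continuous_form.comp (continuous_const.prodMk continuous_id)
  have hc : ContinuousAt (fun w : Hilb K => rotCoeff x w) y := by
    unfold rotCoeff
    have hd : Continuous fun w : Hilb K => 1 + form x w := continuous_const.add hf
    exact ((hd.norm.pow 2).continuousAt.inv₀ h0).smul (continuous_star.comp hd).continuousAt
  have h1 : ContinuousAt (fun w : Hilb K => reflOp (x + w) (rotCoeff x w)) y :=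
    ContinuousAt.comp (f := fun w : Hilb K => (x + w, rotCoeff x w))
      (g := fun p : Hilb K × K => reflOp p.1 p.2) continuous_reflOp.continuousAt
      ((continuous_const.add continuous_id).continuousAt.prodMk hc)
  exact h1.clm_comp continuousAt_const

theorem planeRotOp_self {x : Hilb K} (hx : ‖x‖ = 1) : planeRotOp x x = 1 := by
  have hf : 1 + form x x = algebraMap ℝ K 2 := by
    rw [form_self_of_norm_one hx, map_ofNat]; norm_num
  have hc : rotCoeff x x = algebraMap ℝ K 2⁻¹ := by
    rw [rotCoeff, hf, star_algebraMap, norm_algebraMap', Algebra.smul_def, ← map_mul]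
    norm_num
  have h1 : ∀ z, reflOp (x + x) (rotCoeff x x) z = reflOp x 2 z := by
    intro z
    rw [reflOp_apply, reflOp_apply, hc, form_add_right, ← two_smul K x, smul_smul, ← mul_two]
    congr 2
    have : (2 : K) * algebraMap ℝ K 2⁻¹ = 1 := by
      rw [← map_ofNat (algebraMap ℝ K) 2, ← map_mul]; norm_num
    rw [mul_assoc (form z x), this, mul_one]
  have h2 : star (2 : K) = 2 := by
    rw [← map_ofNat (algebraMap ℝ K) 2, star_algebraMap]
  ext1 z
  change reflOp (x + x) (rotCoeff x x) (reflOp x 2 z) = z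
  rw [h1]
  have := reflOp_reflOp_star (two_spec hx) z
  rwa [h2] at this

/-- The rotation from `x` to `y` is connected to `1` within the unitary group of the coordinates
involved. -/
theorem planeRot_mem_UFin0 {x y : Hilb K} (hx : ‖x‖ = 1) (hy : ‖y‖ = 1) (hxy : x + y ≠ 0) {m : ℕ}
    (hxm : ∀ j, m ≤ j → x j = 0) (hym : ∀ j, m ≤ j → y j = 0) : planeRot x y ∈ UFin0 K m := by
  -- The path rotates `x` towards the points of the normalized segment from `x` to `y`. If the
  -- segment met `0`, or its normalization met `-x`, then `y = -x` would follow.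
  set w : ℝ → Hilb K := fun t => (1 - t) • x + t • y with hw
  have hwc : Continuous w := by fun_prop
  have hxx : x + x ≠ 0 := add_self_ne_zero hx
  have hw0 : ∀ t ∈ Set.Icc (0 : ℝ) 1, w t ≠ 0 := by
    intro t ht h
    have h1 : t • y = -((1 - t) • x) := eq_neg_of_add_eq_zero_right h
    have h2 := congrArg norm h1
    rw [norm_neg, norm_smul, norm_smul, hx, hy, Real.norm_of_nonneg ht.1,
      Real.norm_of_nonneg (by linarith [ht.2])] at h2
    have h3 : t = 1 / 2 := by linarith
    rw [h3] at h
    have h4 : w (1 / 2) = (1 / 2 : ℝ) • (x + y) := by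
      rw [hw]; module
    rw [h4] at h
    exact hxy ((smul_eq_zero.1 h).resolve_left (by norm_num))
  set z : ℝ → Hilb K := fun t => ‖w t‖⁻¹ • w t with hz
  have hzn : ∀ t ∈ Set.Icc (0 : ℝ) 1, ‖z t‖ = 1 := by
    intro t ht
    rw [hz, norm_smul, norm_inv, norm_norm, inv_mul_cancel₀ (norm_ne_zero_iff.2 (hw0 t ht))]
  have hzx : ∀ t ∈ Set.Icc (0 : ℝ) 1, x + z t ≠ 0 := by
    intro t ht h
    have hwt := norm_ne_zero_iff.2 (hw0 t ht)
    have h1 : w t = -(‖w t‖ • x) := by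
      rw [← smul_neg, ← eq_neg_of_add_eq_zero_right h, hz, smul_smul, mul_inv_cancel₀ hwt, one_smul]
    have h2 : t • y = -((‖w t‖ + (1 - t)) • x) := by
      have h3 : t • y = w t - (1 - t) • x := (add_sub_cancel_left _ _).symm
      rw [h3, h1]
      rw [norm_neg, norm_smul, norm_norm, hx, mul_one]
      module
    have h4 := congrArg norm h2
    rw [norm_neg, norm_smul, norm_smul, hx, hy, Real.norm_of_nonneg ht.1, Real.norm_of_nonneg
      (by linarith [ht.2, norm_nonneg (w t)]), mul_one, mul_one] at h4
    rw [← h4, ← smul_neg] at h2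
    have ht0 : t ≠ 0 := by
      intro H
      rw [H] at h4
      have := norm_nonneg (w 0)
      linarith
    have h5 := smul_right_injective (Hilb K) ht0 h2
    exact hxy (by rw [h5, add_neg_cancel])
  have hzc : ContinuousOn z (Set.Icc 0 1) :=
    ContinuousOn.smul (hwc.norm.continuousOn.inv₀ fun t ht => norm_ne_zero_iff.2 (hw0 t ht))
      hwc.continuousOn
  have hzm : ∀ t, ∀ j, m ≤ j → z t j = 0 := by
    intro t j hj
    simp [hz, hw, hxm j hj, hym j hj]
  have hz0 : z 0 = x := by simp [hz, hw, hx]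
  have hz1 : z 1 = y := by simp [hz, hw, hy]
  have hpath : planeRot x (z 1) ∈ UFin0 K m :=
    mem_idComp_of_path (S := UFin K m) (γ := fun t => planeRot x (z t)) ?_ ?_ ?_
  · rwa [hz1] at hpath
  · rw [isInducing_toOp.continuousOn_iff]
    have : ContinuousOn (fun t => planeRotOp x (z t)) (Set.Icc 0 1) := fun t ht =>
      (continuousAt_planeRotOp hx (hzn t ht) (hzx t ht)).comp_continuousWithinAt (hzc t ht)
    exact this.congr fun t ht => toOp_planeRot hx (hzn t ht) (hzx t ht)
  · intro t ht j hj
    exact planeRot_apply_e hx (hzn t ht) (hzx t ht) (hxm j hj) (hzm t j hj)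
  · refine LinearIsometryEquiv.ext fun v => ?_
    simp only [hz0]
    rw [← toOp_apply, toOp_planeRot hx hx hxx, planeRotOp_self hx]
    rfl

/-- A finitely supported vector can be moved to the first `n + 1` coordinates by an element of the
stabilizer of the first `n` basis vectors. -/
theorem exists_stab_apply_coord_eq_zero (n : ℕ) {y : Hilb K} {M : ℕ}
    (hy : ∀ j, M ≤ j → y j = 0) :
    ∃ k ∈ UInf0 K, k ∈ stab K n ∧ ∀ j, n + 1 ≤ j → k y j = 0 := by
  obtain ⟨M', hnM, hy'⟩ : ∃ M', n < M' ∧ ∀ j, M' ≤ j → y j = 0 :=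
    ⟨max M (n + 1), by simp, fun j hj => hy j ((le_max_left _ _).trans hj)⟩
  set p := proj {j | n ≤ j} y with hp
  set q := proj {j | n ≤ j}ᶜ y with hq
  have hpq : p + q = y := proj_add_proj_compl _ y
  have hpj : ∀ j < n, p j = 0 := fun j hj => proj_coord_notMem (not_le.2 hj) y
  have hqj : ∀ j, n ≤ j → q j = 0 := fun j hj => proj_coord_notMem (by simpa using hj) y
  have hpM : ∀ j, M' ≤ j → p j = 0 := fun j hj => by
    rw [hp, proj_coord_mem (show j ∈ {j | n ≤ j} from hnM.le.trans hj), hy' j hj]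
  by_cases hp0 : p = 0
  · refine ⟨1, one_mem _, one_mem _, fun j hj => ?_⟩
    change y j = 0
    rw [← hpq, hp0, zero_add, hqj j (by omega)]
  have hpn : ‖p‖ ≠ 0 := norm_ne_zero_iff.2 hp0
  set x := ‖p‖⁻¹ • p with hx
  have hx1 : ‖x‖ = 1 := by rw [hx, norm_smul, norm_inv, norm_norm, inv_mul_cancel₀ hpn]
  have hxM : x M' = 0 := by rw [hx, real_smul_coord, hpM M' le_rfl, smul_zero]
  have h1 : x + e K M' ≠ 0 := by
    intro h
    have := congrArg (fun z : Hilb K => z M') h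
    simp [hxM] at this
  have h2 : e K M' + e K n ≠ 0 := by
    intro h
    have := congrArg (fun z : Hilb K => z M') h
    simp [e_coord_ne hnM.ne'] at this
  -- The detour through `e M'`, orthogonal to both `x` and `e n`, is needed because `x` may equal
  -- `-e n`, where the plane rotation takes its default value `1`.
  set k₁ := planeRot x (e K M') with hk₁
  set k₂ := planeRot (e K M') (e K n) with hk₂
  have hk₁m : k₁ ∈ UInf0 K := ⟨M' + 1, planeRot_mem_UFin0 hx1 (norm_e _) h1
    (fun j hj => by rw [hx, real_smul_coord, hpM j (by omega), smul_zero])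
    (fun j hj => e_coord_ne (by omega))⟩
  have hk₂m : k₂ ∈ UInf0 K := ⟨M' + 1, planeRot_mem_UFin0 (norm_e _) (norm_e _) h2
    (fun j hj => e_coord_ne (by omega)) (fun j hj => e_coord_ne (by omega))⟩
  have hk₁n : k₁ ∈ stab K n := fun j hj => planeRot_apply_e hx1 (norm_e _) h1
    (by rw [hx, real_smul_coord, hpj j hj, smul_zero]) (e_coord_ne (by omega))
  have hk₂n : k₂ ∈ stab K n := fun j hj => planeRot_apply_e (norm_e _) (norm_e _) h2
    (e_coord_ne (by omega)) (e_coord_ne (by omega))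
  have hkn : k₂ * k₁ ∈ stab K n := mul_mem hk₂n hk₁n
  refine ⟨k₂ * k₁, mul_mem hk₂m hk₁m, hkn, fun j hj => ?_⟩
  have hkq : (k₂ * k₁) q = q := UFull.apply_eq_self fun i hi =>
    hkn i (not_le.1 fun H => hi (hqj i H))
  have hkp : (k₂ * k₁) p = ‖p‖ • e K n := by
    have : p = ‖p‖ • x := by rw [hx, smul_smul, mul_inv_cancel₀ hpn, one_smul]
    conv_lhs => rw [this]
    rw [map_real_smul, UFull.mul_apply, hk₁, planeRot_apply_self hx1 (norm_e _) h1, hk₂,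
      planeRot_apply_self (norm_e _) (norm_e _) h2]
  rw [← hpq, map_add, hkq, hkp, add_coord, real_smul_coord, e_coord_ne (by omega),
    hqj j (by omega), smul_zero, add_zero]

end PlaneRotations

/-! ### Tame representations are norm-continuous -/

section Tame

variable {K : Type} [NormedDivisionRing K] [NormedAlgebra ℝ K] [StarRing K] [StarNormSq K]
  [FiniteDimensional ℝ K]
variable {V : Type*} [NormedAddCommGroup V] [InnerProductSpace ℂ V]
variable {π : UInf0 K →* (V ≃ₗᵢ[ℂ] V)}

theorem exists_norm_sub_lt_of_mem_UFin0 (hπ : IsContinuousRep (dirLimTopology K) π) (v : V)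
    (m : ℕ) {ε : ℝ} (hε : 0 < ε) :
    ∃ δ > 0, ∀ g : UInf0 K, (g : UFull K) ∈ UFin0 K m → ‖toOp K g - 1‖ < δ → ‖π g v - v‖ < ε := by
  have h1 : Continuous fun g : UFin0 K m => π (Subgroup.inclusion (UFin0_le m) g) v :=
    continuous_coinduced_dom.1 (continuous_iSup_dom.1 (hπ v) m)
  have h2 : (fun g : UFin0 K m => π (Subgroup.inclusion (UFin0_le m) g) v) ⁻¹'
      Metric.ball v ε ∈ 𝓝 (1 : UFin0 K m) := by
    refine h1.continuousAt.preimage_mem_nhds ?_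
    simpa using Metric.ball_mem_nhds v hε
  rw [nhds_subtype_eq_comap, Filter.mem_comap] at h2
  obtain ⟨s, hs, hs'⟩ := h2
  obtain ⟨δ, hδ, hδs⟩ := mem_nhds_one_iff.1 hs
  refine ⟨δ, hδ, fun g hg hgδ => ?_⟩
  have := hs' (a := ⟨g, hg⟩) (hδs g hgδ)
  rwa [Set.mem_preimage, Metric.mem_ball, dist_eq_norm] at this

/-- Direct limit continuity gives no uniform `δ` for vectors `y` of unbounded support. An element
`k` of the stabilizer fixes `v` and `e i` and brings `y` into the first `n + 1` coordinates, so the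
rotation is conjugate to one in U(n+1, K)_0 and moves `v` by the same amount. -/
theorem exists_planeRot_small (hπ : IsContinuousRep (dirLimTopology K) π) {n : ℕ} {v : V}
    (hv : v ∈ fixedSpace π n) {i : ℕ} (hi : i < n) {ε : ℝ} (hε : 0 < ε) :
    ∃ δ > 0, ∀ y : Hilb K, ‖y‖ = 1 → (∃ M, ∀ j, M ≤ j → y j = 0) → ‖y - e K i‖ < δ →
      e K i + y ≠ 0 ∧ ‖toOp K (planeRot (e K i) y) - 1‖ < ε ∧
      ∃ h : planeRot (e K i) y ∈ UInf0 K, ‖π ⟨_, h⟩ v - v‖ < ε := by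
  obtain ⟨ε', hε', hπε⟩ := exists_norm_sub_lt_of_mem_UFin0 hπ v (n + 1) hε
  have hee : e K i + e K i ≠ 0 := add_self_ne_zero (norm_e i)
  have hc := continuousAt_planeRotOp (norm_e i) (norm_e i) hee
  obtain ⟨δ, hδ, hδε⟩ := Metric.continuousAt_iff.1 hc (min ε ε') (lt_min hε hε')
  -- The bound `2` excludes `y = -e i`, which lies at distance exactly `2` from `e i`.
  refine ⟨min δ 2, by positivity, fun y hy ⟨M, hM⟩ hyi => ?_⟩
  have hne : ∀ y : Hilb K, ‖y - e K i‖ < min δ 2 → e K i + y ≠ 0 := by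
    intro y hyi h
    rw [eq_neg_of_add_eq_zero_right h, ← neg_add', norm_neg, ← two_smul ℝ, norm_smul, norm_e,
      Real.norm_of_nonneg (by norm_num), mul_one] at hyi
    exact (min_le_right δ 2).not_gt hyi
  have hsmall : ∀ y : Hilb K, ‖y‖ = 1 → ‖y - e K i‖ < min δ 2 →
      ‖toOp K (planeRot (e K i) y) - 1‖ < min ε ε' := by
    intro y hy hyi
    have := hδε (x := y) (by rw [dist_eq_norm]; exact hyi.trans_le (min_le_left _ _))
    rwa [dist_eq_norm, planeRotOp_self (norm_e i), ← toOp_planeRot (norm_e i) hy (hne y hyi)] at this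
  have hmem : planeRot (e K i) y ∈ UInf0 K := ⟨max M (i + 1), planeRot_mem_UFin0 (norm_e i) hy
    (hne y hyi) (fun j hj => e_coord_ne (by
      have := (le_max_right M (i + 1)).trans hj
      omega)) (fun j hj => hM j ((le_max_left _ _).trans hj))⟩
  refine ⟨hne y hyi, (hsmall y hy hyi).trans_le (min_le_left _ _), hmem, ?_⟩
  obtain ⟨k, hk, hkn, hky⟩ := exists_stab_apply_coord_eq_zero n hM
  have hke : k (e K i) = e K i := hkn i hi
  have hky1 : ‖k y‖ = 1 := by rw [LinearIsometryEquiv.norm_map, hy]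
  have hkyi : ‖k y - e K i‖ < min δ 2 := by
    rw [← hke, ← map_sub, LinearIsometryEquiv.norm_map]
    exact hyi
  have hconj : k * planeRot (e K i) y * k⁻¹ = planeRot (e K i) (k y) := by
    rw [conj_planeRot (norm_e i) hy (hne y hyi), hke]
  have hmem' : planeRot (e K i) (k y) ∈ UFin0 K (n + 1) :=
    planeRot_mem_UFin0 (norm_e i) hky1 (hne _ hkyi) (fun j hj => e_coord_ne (by omega)) hky
  have h1 := hπε ⟨_, UFin0_le _ hmem'⟩ hmem' ((hsmall _ hky1 hkyi).trans_le (min_le_right _ _))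
  have h2 : (⟨_, UFin0_le _ hmem'⟩ : UInf0 K) = ⟨k, hk⟩ * ⟨_, hmem⟩ * ⟨k, hk⟩⁻¹ :=
    Subtype.ext hconj.symm
  have h3 : π (⟨k, hk⟩⁻¹) v = v := hv _ (inv_mem hkn)
  have h4 : π (⟨k, hk⟩ * ⟨_, hmem⟩ * ⟨k, hk⟩⁻¹) v = π ⟨k, hk⟩ (π ⟨_, hmem⟩ v) := by
    rw [map_mul, map_mul]
    change π ⟨k, hk⟩ (π ⟨_, hmem⟩ (π (⟨k, hk⟩⁻¹) v)) = _
    rw [h3]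
  have h5 : π ⟨k, hk⟩ v = v := hv _ hkn
  rw [h2, h4] at h1
  rwa [← (π ⟨k, hk⟩).norm_map, map_sub, h5]

/-- Downward induction on `i` from `n`, where `v` is fixed. Writing `g = r k` with `r` the plane
rotation from `e i` to `g (e i)`, the factor `r` moves `v` little and `k` fixes one more basis
vector. -/
theorem exists_norm_sub_lt_of_mem_stab (hπ : IsContinuousRep (dirLimTopology K) π) {n : ℕ} {v : V}
    (hv : v ∈ fixedSpace π n) {i : ℕ} (hi : i ≤ n) : ∀ ε > 0, ∃ δ > 0, ∀ g : UInf0 K,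
      (g : UFull K) ∈ stab K i → (∀ j < n, ‖(g : UFull K) (e K j) - e K j‖ < δ) →
      ‖π g v - v‖ < ε := by
  induction hi using Nat.decreasingInduction with
  | self =>
    intro ε hε
    exact ⟨1, one_pos, fun g hg _ => by rw [hv g hg, sub_self, norm_zero]; exact hε⟩
  | of_succ i hi ih =>
    intro ε hε
    obtain ⟨δ, hδ, hδε⟩ := ih (ε / 2) (by positivity)
    obtain ⟨δ', hδ', hδε'⟩ := exists_planeRot_small hπ hv hi (ε := min (δ / 2) (ε / 2))
      (by positivity)
    -- `‖k e_j - e_j‖ = ‖g e_j - r e_j‖` is bounded by the displacements of `e_j` under `g` and `r`,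
    -- so each may use half of `δ`.
    refine ⟨min (δ / 2) δ', by positivity, fun g hg hgδ => ?_⟩
    obtain ⟨M, hM⟩ := UInf0_le_preservesFinSupp g.2 (i + 1)
    have hy1 : ‖(g : UFull K) (e K i)‖ = 1 := by rw [LinearIsometryEquiv.norm_map, norm_e]
    obtain ⟨hne, hr, hrU, hrv⟩ := hδε' ((g : UFull K) (e K i)) hy1
      ⟨M, hM _ fun k hk => e_coord_ne (by omega)⟩ ((hgδ i hi).trans_le (min_le_right _ _))
    set r := planeRot (e K i) ((g : UFull K) (e K i)) with hrdef
    obtain ⟨s, hs⟩ : ∃ s : UInf0 K, s = ⟨r, hrU⟩ := ⟨_, rfl⟩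
    have hsr : (s : UFull K) = r := by rw [hs]
    obtain ⟨k, hk⟩ : ∃ k : UInf0 K, k = s⁻¹ * g := ⟨_, rfl⟩
    have hkr : (k : UFull K) = r⁻¹ * g := by rw [hk, Subgroup.coe_mul, Subgroup.coe_inv, hsr]
    rw [← hs] at hrv
    have hstab : (k : UFull K) ∈ stab K (i + 1) := by
      intro j hj
      rw [hkr, UFull.mul_apply]
      refine UFull.inv_apply_eq ?_
      -- For `j < i` both `e i` and `g (e i)` are orthogonal to `e j = g (e j)`, so `r` fixes `e j`
      -- as well.
      rcases Nat.lt_succ_iff_lt_or_eq.1 hj with h | rfl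
      · rw [hg j h]
        refine planeRot_apply_e (norm_e i) hy1 hne (e_coord_ne h.ne) ?_
        rw [UFull.coord_eq (hg j h), e_coord_ne h.ne]
      · exact planeRot_apply_self (norm_e j) hy1 hne
    have h1 := hδε k hstab fun j hj => by
      have h2 : ‖(k : UFull K) (e K j) - e K j‖ =
          ‖((g : UFull K) (e K j) - e K j) - (r (e K j) - e K j)‖ := by
        rw [← r.norm_map, map_sub, hkr, UFull.mul_apply, UFull.apply_inv_self,
          sub_sub_sub_cancel_right]
      have h3 := norm_apply_sub_le (le_refl ‖toOp K r - 1‖) (e K j)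
      rw [norm_e, mul_one] at h3
      have h4 := norm_sub_le ((g : UFull K) (e K j) - e K j) (r (e K j) - e K j)
      have h5 := (hgδ j hj).trans_le (min_le_left _ _)
      have h6 := hr.trans_le (min_le_left _ _)
      linarith
    have hgs : π g v = π s (π k v) := by
      rw [hk, map_mul]
      change _ = (π s * (π s⁻¹ * π g)) v
      rw [← map_mul, ← map_mul, mul_inv_cancel_left]
    have h7 : π g v - v = π s (π k v - v) + (π s v - v) := by
      rw [hgs, map_sub, sub_add_sub_cancel]
    have h8 := norm_add_le (π s (π k v - v)) (π s v - v)
    rw [← h7, LinearIsometryEquiv.norm_map] at h8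
    have h9 := hrv.trans_le (min_le_right _ _)
    linarith

theorem IsTame.isNormContinuous (h : IsTame π) (hπ : IsContinuousRep (dirLimTopology K) π) :
    IsNormContinuous π := by
  intro v δ hδ
  obtain ⟨w, hw, hwn⟩ := Metric.dense_iff.1 h v (δ / 3) (by positivity)
  obtain ⟨n, hn⟩ := Set.mem_iUnion.1 hwn
  obtain ⟨ε, hε, hεδ⟩ := exists_norm_sub_lt_of_mem_stab hπ hn (Nat.zero_le n) (δ / 3)
    (by positivity)
  refine ⟨ε, hε, fun g hg => ?_⟩
  have h1 := hεδ g (fun j hj => absurd hj (Nat.not_lt_zero j)) fun j _ => by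
    have := norm_apply_sub_le (le_refl ‖toOp K (g : UFull K) - 1‖) (e K j)
    rw [norm_e, mul_one] at this
    exact this.trans_lt hg
  rw [Metric.mem_ball, dist_eq_norm] at hw
  have h2 : π g v - v = (π g w - w) + (w - v) - π g (w - v) := by rw [map_sub]; abel
  have h3 := norm_sub_le ((π g w - w) + (w - v)) (π g (w - v))
  have h4 := norm_add_le (π g w - w) (w - v)
  rw [← h2, LinearIsometryEquiv.norm_map] at h3
  linarith

end Tame

/-! ### The Cayley transform and density of `U(∞, K)_0` -/

section Cayley

variable {K : Type} [NormedDivisionRing K] [NormedAlgebra ℝ K] [StarRing K] [StarNormSq K]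
  [FiniteDimensional ℝ K]

/-- Skew-adjoint operators commuting with scalars, of norm less than one. -/
structure IsSmallSkew (X : Hilb K →L[ℝ] Hilb K) : Prop where
  norm_lt : ‖X‖ < 1
  map_smul (a : K) (x : Hilb K) : X (a • x) = a • X x
  skew (x y : Hilb K) : form (X x) y = -form x (X y)

/-- The Cayley transform `(1 - X) (1 + X)⁻¹`. -/
def cayleyOp (X : Hilb K →L[ℝ] Hilb K) : Hilb K →L[ℝ] Hilb K := (1 - X) * Ring.inverse (1 + X)

theorem isUnit_one_add_of_norm_lt_one {X : Hilb K →L[ℝ] Hilb K} (h : ‖X‖ < 1) :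
    IsUnit (1 + X) := by
  have := isUnit_one_sub_of_norm_lt_one (x := -X) (by rwa [norm_neg])
  rwa [sub_neg_eq_add] at this

theorem continuousAt_cayleyOp {X : Hilb K →L[ℝ] Hilb K} (h : ‖X‖ < 1) :
    ContinuousAt cayleyOp X := by
  obtain ⟨u, hu⟩ := isUnit_one_add_of_norm_lt_one h
  have h1 : ContinuousAt Ring.inverse (1 + X) := hu ▸ NormedRing.inverse_continuousAt u
  have h2 : ContinuousAt (fun Y : Hilb K →L[ℝ] Hilb K => Ring.inverse (1 + Y)) X :=
    ContinuousAt.comp (f := fun Y : Hilb K →L[ℝ] Hilb K => 1 + Y) h1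
      (continuous_const.add continuous_id).continuousAt
  exact (continuous_const.sub continuous_id).continuousAt.mul h2

theorem cayleyOp_mul_one_add {X : Hilb K →L[ℝ] Hilb K} (h : ‖X‖ < 1) :
    cayleyOp X * (1 + X) = 1 - X := by
  rw [cayleyOp, mul_assoc, Ring.inverse_mul_cancel _ (isUnit_one_add_of_norm_lt_one h), mul_one]

theorem cayleyOp_apply_one_add {X : Hilb K →L[ℝ] Hilb K} (h : ‖X‖ < 1) (z : Hilb K) :
    cayleyOp X (z + X z) = z - X z :=
  DFunLike.congr_fun (cayleyOp_mul_one_add h) z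

/-- Substituting `z + X z` for the argument reduces statements about the Cayley transform to ones
without inverses. -/
theorem exists_add_eq {X : Hilb K →L[ℝ] Hilb K} (h : ‖X‖ < 1) (w : Hilb K) :
    ∃ z, w = z + X z :=
  ⟨Ring.inverse (1 + X) w, (DFunLike.congr_fun
    (Ring.mul_inverse_cancel _ (isUnit_one_add_of_norm_lt_one h)) w).symm⟩

theorem cayleyOp_neg_mul {X : Hilb K →L[ℝ] Hilb K} (h : ‖X‖ < 1) :
    cayleyOp (-X) * cayleyOp X = 1 := by
  have h' : ‖-X‖ < 1 := by rwa [norm_neg]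
  have h1 := cayleyOp_mul_one_add h'
  rw [← sub_eq_add_neg, sub_neg_eq_add] at h1
  rw [cayleyOp.eq_1 X, ← mul_assoc, h1,
    Ring.mul_inverse_cancel _ (isUnit_one_add_of_norm_lt_one h)]

theorem cayleyOp_mul_neg {X : Hilb K →L[ℝ] Hilb K} (h : ‖X‖ < 1) :
    cayleyOp X * cayleyOp (-X) = 1 := by
  have h1 := cayleyOp_neg_mul (X := -X) (by rwa [norm_neg])
  rwa [neg_neg] at h1

namespace IsSmallSkew

theorem cayleyOp_smul {X : Hilb K →L[ℝ] Hilb K} (hX : IsSmallSkew X) (a : K) (w : Hilb K) :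
    cayleyOp X (a • w) = a • cayleyOp X w := by
  obtain ⟨z, rfl⟩ := exists_add_eq hX.norm_lt w
  rw [cayleyOp_apply_one_add hX.norm_lt, smul_add, ← hX.map_smul,
    cayleyOp_apply_one_add hX.norm_lt, hX.map_smul, smul_sub]

/-- Skewness cancels the cross terms of `form`, so `z - X z` and `z + X z` have equal norms. -/
theorem norm_cayleyOp {X : Hilb K →L[ℝ] Hilb K} (hX : IsSmallSkew X) (w : Hilb K) :
    ‖cayleyOp X w‖ = ‖w‖ := by
  obtain ⟨z, rfl⟩ := exists_add_eq hX.norm_lt w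
  rw [cayleyOp_apply_one_add hX.norm_lt]
  have h1 : form (z - X z) (z - X z) = form (z + X z) (z + X z) := by
    simp only [form_sub_left, form_sub_right, form_add_left, form_add_right, hX.skew z z]
    abel
  rw [form_self, form_self] at h1
  exact (sq_eq_sq₀ (norm_nonneg _) (norm_nonneg _)).1 ((algebraMap ℝ K).injective h1)

theorem smul {X : Hilb K →L[ℝ] Hilb K} (hX : IsSmallSkew X) {t : ℝ} (ht : |t| ≤ 1) :
    IsSmallSkew (t • X) where
  norm_lt := by
    rw [norm_smul, Real.norm_eq_abs]
    exact (mul_le_of_le_one_left (norm_nonneg _) ht).trans_lt hX.norm_lt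
  map_smul a x := by
    rw [_root_.smul_apply, _root_.smul_apply, hX.map_smul,
      smul_real_smul]
  skew x y := by
    rw [_root_.smul_apply, _root_.smul_apply, form_real_smul_left,
      form_real_smul_right, hX.skew, smul_neg]

end IsSmallSkew

open Classical in
/-- The Cayley transform as a unitary operator. -/
def cayley (X : Hilb K →L[ℝ] Hilb K) : UFull K :=
  if h : IsSmallSkew X then
    mkU (cayleyOp X) (cayleyOp (-X)) h.cayleyOp_smul
      (DFunLike.congr_fun (cayleyOp_neg_mul h.norm_lt))
      (DFunLike.congr_fun (cayleyOp_mul_neg h.norm_lt)) h.norm_cayleyOp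
  else 1

theorem toOp_cayley {X : Hilb K →L[ℝ] Hilb K} (h : IsSmallSkew X) :
    toOp K (cayley X) = cayleyOp X := by
  rw [cayley, dif_pos h]
  rfl

theorem cayley_zero : cayley (0 : Hilb K →L[ℝ] Hilb K) = 1 := by
  have h : IsSmallSkew (0 : Hilb K →L[ℝ] Hilb K) :=
    ⟨by simp, fun a x => by simp, fun x y => by
      have := form_smul_left (0 : K) x y
      have h' := form_smul_right (0 : K) x y
      simp only [zero_smul, zero_mul, star_zero, mul_zero] at this h'
      simp [this, h']⟩
  refine LinearIsometryEquiv.ext fun z => ?_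
  have h2 := cayleyOp_apply_one_add h.norm_lt z
  rw [← toOp_apply, toOp_cayley h]
  simpa using h2

theorem cayley_mem_UFin0 {X : Hilb K →L[ℝ] Hilb K} (hX : IsSmallSkew X) {n : ℕ}
    (hn : ∀ j, n ≤ j → X (e K j) = 0) : cayley X ∈ UFin0 K n := by
  have ht : ∀ t ∈ Set.Icc (0 : ℝ) 1, IsSmallSkew (t • X) := fun t ht =>
    hX.smul (by rw [abs_of_nonneg ht.1]; exact ht.2)
  have h : cayley ((1 : ℝ) • X) ∈ UFin0 K n :=
    mem_idComp_of_path (S := UFin K n) (γ := fun t : ℝ => cayley (t • X)) ?_ ?_ ?_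
  · rwa [one_smul] at h
  · rw [isInducing_toOp.continuousOn_iff]
    have : ContinuousOn (fun t : ℝ => cayleyOp (t • X)) (Set.Icc 0 1) := fun t h =>
      ContinuousAt.continuousWithinAt (ContinuousAt.comp (f := fun t : ℝ => t • X)
        (continuousAt_cayleyOp (ht t h).norm_lt)
        (continuous_id.smul continuous_const).continuousAt)
    exact this.congr fun t h => toOp_cayley (ht t h)
  · intro t h j hj
    have h1 := cayleyOp_apply_one_add (ht t h).norm_lt (e K j)
    rw [_root_.smul_apply, hn j hj, smul_zero, add_zero, sub_zero] at h1
    rw [← toOp_apply, toOp_cayley (ht t h), h1]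
  · simp only [zero_smul, cayley_zero]

/-- Unitary operators close to `1` are Cayley transforms. -/
theorem exists_cayley_eq {g : UFull K} (hg : ‖toOp K g - 1‖ < 1) :
    ∃ X, IsSmallSkew X ∧ cayley X = g ∧ (g ∈ UCompact K → IsCompactOperator X) := by
  -- Since `1 - h = (1 + g) / 2`, the operator `h (1 - h)⁻¹` is the inverse Cayley transform `(1 -
  -- g) (1 + g)⁻¹`. The bound `‖h‖ < 1 / 2` makes its norm less than `1`.
  set h : Hilb K →L[ℝ] Hilb K := (2⁻¹ : ℝ) • (1 - toOp K g) with hh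
  have hnorm : ‖h‖ < 2⁻¹ := by
    rw [hh, norm_smul, norm_sub_rev, Real.norm_of_nonneg (by norm_num)]
    linarith
  have hu : IsUnit (1 - h) := isUnit_one_sub_of_norm_lt_one (by linarith)
  have happ : ∀ z, h z = (2⁻¹ : ℝ) • (z - g z) := fun z => rfl
  set X := h * Ring.inverse (1 - h) with hXdef
  have hX : ∀ z, X (z - h z) = h z := by
    intro z
    have : X * (1 - h) = h := by rw [hXdef, mul_assoc, Ring.inverse_mul_cancel _ hu, mul_one]
    exact DFunLike.congr_fun this z
  have hex : ∀ w, ∃ z, w = z - h z := fun w =>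
    ⟨Ring.inverse (1 - h) w, (DFunLike.congr_fun (Ring.mul_inverse_cancel _ hu) w).symm⟩
  have hsmul : ∀ (a : K) z, h (a • z) = a • h z := by
    intro a z
    rw [happ, happ, map_smul, ← smul_sub, smul_real_smul]
  have hsk : IsSmallSkew X := by
    refine ⟨?_, ?_, ?_⟩
    · have h1 : ‖X‖ ≤ ‖h‖ / (1 - ‖h‖) := by
        refine ContinuousLinearMap.opNorm_le_bound _
          (div_nonneg (norm_nonneg _) (by linarith)) fun w => ?_
        obtain ⟨z, rfl⟩ := hex w
        rw [hX, div_mul_eq_mul_div, le_div_iff₀ (by linarith)]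
        have h2 := h.le_opNorm z
        have h3 := norm_sub_norm_le z (h z)
        have h4 : (1 - ‖h‖) * ‖z‖ ≤ ‖z - h z‖ := by linarith
        have h5 : ‖h z‖ * (1 - ‖h‖) ≤ ‖h‖ * ‖z‖ * (1 - ‖h‖) :=
          mul_le_mul_of_nonneg_right h2 (by linarith)
        have h6 : ‖h‖ * ((1 - ‖h‖) * ‖z‖) ≤ ‖h‖ * ‖z - h z‖ :=
          mul_le_mul_of_nonneg_left h4 (norm_nonneg _)
        linarith
      refine h1.trans_lt ?_
      rw [div_lt_one (by linarith)]
      linarith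
    · intro a w
      obtain ⟨z, rfl⟩ := hex w
      rw [hX, smul_sub, ← hsmul, hX]
    · intro w w'
      obtain ⟨z, rfl⟩ := hex w
      obtain ⟨z', rfl⟩ := hex w'
      rw [hX, hX, happ, happ]
      simp only [form_sub_left, form_sub_right, form_real_smul_left, form_real_smul_right,
        form_map]
      module
  refine ⟨X, hsk, ?_, ?_⟩
  · refine LinearIsometryEquiv.ext fun w => ?_
    obtain ⟨v, rfl⟩ := exists_add_eq hsk.norm_lt w
    obtain ⟨z, rfl⟩ := hex v
    rw [← toOp_apply, toOp_cayley hsk, cayleyOp_apply_one_add hsk.norm_lt, hX, sub_add_cancel,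
      happ]
    module
  · intro hgc
    have h1 : IsCompactOperator (fun x : Hilb K => -(g x - x)) := IsCompactOperator.neg hgc
    have h2 : IsCompactOperator (h : Hilb K → Hilb K) := by
      have h3 := IsCompactOperator.smul (S := ℝ) h1 (2⁻¹ : ℝ)
      have h4 : (h : Hilb K → Hilb K) = (2⁻¹ : ℝ) • fun x : Hilb K => -(g x - x) := by
        funext z
        rw [happ, Pi.smul_apply, neg_sub]
      rwa [h4]
    exact h2.comp_clm (Ring.inverse (1 - h))

/-! ### Finite compressions of compact skew-adjoint operators -/

theorem tendsto_proj (y : Hilb K) :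
    Filter.Tendsto (fun n : ℕ => proj {j | j < n}ᶜ y) Filter.atTop (𝓝 0) := by
  have h1 := (hasSum_coord_smul_e y).tendsto_sum_nat
  have h2 : ∀ n : ℕ, proj {j | j < n}ᶜ y = y - ∑ j ∈ Finset.range n, y j • e K j := by
    intro n
    ext i
    rw [sub_coord, lp.coeFn_sum, Finset.sum_apply]
    simp only [smul_coord, e_coord, mul_ite, mul_one, mul_zero]
    by_cases hi : i < n
    · rw [proj_coord_notMem (by simpa using hi)]
      simp [hi]
    · rw [proj_coord_mem (by simpa using hi)]
      simp [hi]
  simp only [h2]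
  simpa using (tendsto_const_nhds (x := y)).sub h1

/-- The tail projections are contractions tending strongly to `0`, hence uniformly on the relatively
compact image of the unit ball: it suffices to control a finite net. -/
theorem tendsto_norm_proj_mul {X : Hilb K →L[ℝ] Hilb K} (hX : IsCompactOperator X) :
    Filter.Tendsto (fun n : ℕ => ‖proj {j | j < n}ᶜ * X‖) Filter.atTop (𝓝 0) := by
  rw [Metric.tendsto_atTop]
  intro ε hε
  obtain ⟨C, hC, hXC⟩ := hX.image_closedBall_subset_compact (f := (X : Hilb K →ₗ[ℝ] Hilb K)) 1
  obtain ⟨t, -, ht, hCt⟩ := finite_cover_balls_of_compact hC (show 0 < ε / 3 by positivity)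
  have h1 : ∀ᶠ n : ℕ in Filter.atTop, ∀ y ∈ t, ‖proj {j | j < n}ᶜ y‖ < ε / 3 := by
    rw [Filter.eventually_all_finite ht]
    intro y _
    have := (tendsto_proj y).norm
    rw [norm_zero] at this
    exact this.eventually (gt_mem_nhds (by positivity))
  obtain ⟨N, hN⟩ := Filter.eventually_atTop.1 h1
  refine ⟨N, fun n hn => ?_⟩
  rw [Real.dist_eq, sub_zero, abs_norm]
  have h2 : ‖proj {j | j < n}ᶜ * X‖ ≤ ε / 3 + ε / 3 := by
    refine ContinuousLinearMap.opNorm_le_of_unit_norm (by positivity) fun x hx => ?_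
    have hxC : X x ∈ C := hXC ⟨x, by simp [hx], rfl⟩
    obtain ⟨y, hy, hxy⟩ := Set.mem_iUnion₂.1 (hCt hxC)
    rw [Metric.mem_ball, dist_eq_norm] at hxy
    have h3 : (proj {j | j < n}ᶜ * X : Hilb K →L[ℝ] Hilb K) x = proj {j | j < n}ᶜ (X x - y) + proj {j | j < n}ᶜ y := by
      rw [← map_add, sub_add_cancel]; rfl
    rw [h3]
    have h4 := ContinuousLinearMap.le_of_opNorm_le _ (norm_proj_le {j | j < n}ᶜ) (X x - y)
    have h5 := hN n hn y hy
    have h6 := norm_add_le (proj {j | j < n}ᶜ (X x - y)) (proj {j | j < n}ᶜ y)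
    linarith
  linarith

theorem form_proj_left (S : Set ℕ) (x y : Hilb K) : form (proj S x) y = form x (proj S y) := by
  rw [form, form]
  refine tsum_congr fun j => ?_
  by_cases h : j ∈ S <;> simp [proj_coord, h]

/-- `X * proj S` is minus the adjoint of `proj S * X`; the Cauchy–Schwarz inequality replaces the
use of adjoints. -/
theorem norm_mul_proj_le {X : Hilb K →L[ℝ] Hilb K} (hX : IsSmallSkew X) (S : Set ℕ) :
    ‖X * proj S‖ ≤ ‖proj S * X‖ := by
  refine ContinuousLinearMap.opNorm_le_bound _ (norm_nonneg _) fun w => ?_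
  set z := X (proj S w) with hz
  have h1 : ‖z‖ ^ 2 ≤ ‖w‖ * (‖proj S * X‖ * ‖z‖) := by
    have h2 : form z z = -form w ((proj S * X : Hilb K →L[ℝ] Hilb K) z) := by
      conv_lhs => rw [hz, hX.skew, form_proj_left]
      rfl
    rw [← norm_form_self, h2, norm_neg]
    exact (norm_form_le _ _).trans
      (mul_le_mul_of_nonneg_left ((proj S * X : Hilb K →L[ℝ] Hilb K).le_opNorm z) (norm_nonneg _))
  change ‖z‖ ≤ _
  rcases (norm_nonneg z).eq_or_lt with h | h
  · rw [← h]; positivity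
  · refine le_of_mul_le_mul_right ?_ h
    linarith

theorem IsSmallSkew.compress {X : Hilb K →L[ℝ] Hilb K} (hX : IsSmallSkew X) (S : Set ℕ) :
    IsSmallSkew (proj S * X * proj S) where
  norm_lt := by
    have h1 := norm_mul_le (proj S * X) (proj S : Hilb K →L[ℝ] Hilb K)
    have h2 := norm_mul_le (proj S : Hilb K →L[ℝ] Hilb K) X
    have h3 := norm_proj_le (K := K) S
    have h4 := mul_le_of_le_one_right (norm_nonneg (proj S * X : Hilb K →L[ℝ] Hilb K)) h3
    have h5 := mul_le_of_le_one_left (norm_nonneg X) h3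
    linarith [hX.norm_lt]
  map_smul a x := by
    change proj S (X (proj S (a • x))) = a • proj S (X (proj S x))
    rw [proj_smul, hX.map_smul, proj_smul]
  skew x y := by
    change form (proj S (X (proj S x))) y = -form x (proj S (X (proj S y)))
    rw [form_proj_left, hX.skew, form_proj_left]

/-- With `P` the truncation and `Q = 1 - P`, the error is `-(Q X + P X Q)`. Compactness makes `Q X`
small, and skewness bounds `X Q` by it. -/
theorem tendsto_compress {X : Hilb K →L[ℝ] Hilb K} (hX : IsSmallSkew X)
    (hc : IsCompactOperator X) :
    Filter.Tendsto (fun n : ℕ => proj {j | j < n} * X * proj {j | j < n}) Filter.atTop (𝓝 X) := by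
  rw [tendsto_iff_norm_sub_tendsto_zero]
  have h0 := (tendsto_norm_proj_mul hc).add (tendsto_norm_proj_mul hc)
  rw [add_zero] at h0
  refine squeeze_zero (fun _ => norm_nonneg _) (fun n => ?_) h0
  set P : Hilb K →L[ℝ] Hilb K := proj {j | j < n} with hP
  set Q : Hilb K →L[ℝ] Hilb K := proj {j | j < n}ᶜ with hQ
  have hPQ : P = 1 - Q := by
    ext1 x
    exact eq_sub_of_add_eq (proj_add_proj_compl {j | j < n} x)
  have h1 : P * X * P - X = -(Q * X + P * (X * Q)) := by
    have : P * X * P = P * X * (1 - Q) := by rw [← hPQ]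
    rw [this, mul_sub, mul_one, mul_assoc]
    nth_rw 1 [hPQ]
    rw [sub_mul, one_mul]
    abel
  rw [h1, norm_neg]
  refine (norm_add_le _ _).trans (add_le_add le_rfl ((norm_mul_le _ _).trans ?_))
  exact (mul_le_of_le_one_left (norm_nonneg _) (norm_proj_le _)).trans (norm_mul_proj_le hX _)

/-- `U(∞, K)_0` is dense in `U_∞(ℓ²(ℕ, K))_0`. -/
theorem UCompact0_le_topologicalClosure : UCompact0 K ≤ (UInf0 K).topologicalClosure := by
  -- Connectedness reduces density to the generators within distance `1` of the identity, which are
  -- Cayley transforms.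
  refine (idComp_le_closure (UCompact K) (ball_mem_nhds_one one_pos)).trans ?_
  rw [Subgroup.closure_le]
  rintro g ⟨hg, hgc⟩
  obtain ⟨X, hX, rfl, hXc⟩ := exists_cayley_eq hg
  have hcomp := hXc (idComp_le _ hgc)
  have hlim : Filter.Tendsto
      (fun n : ℕ => cayley (proj {j | j < n} * X * proj {j | j < n})) Filter.atTop
      (𝓝 (cayley X)) := by
    rw [isInducing_toOp.tendsto_nhds_iff, toOp_cayley hX]
    have := (continuousAt_cayleyOp hX.norm_lt).tendsto.comp (tendsto_compress hX hcomp)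
    exact this.congr fun n => (toOp_cayley (hX.compress _)).symm
  refine mem_closure_of_tendsto hlim (Filter.Eventually.of_forall fun n => ?_)
  refine ⟨n, cayley_mem_UFin0 (hX.compress _) fun j hj => ?_⟩
  have h1 : (proj {j | j < n} : Hilb K →L[ℝ] Hilb K) (e K j) = 0 := by
    ext i
    by_cases hi : i < n
    · rw [proj_coord_mem (show i ∈ {j | j < n} from hi), e_coord_ne (by omega), zero_coord]
    · rw [proj_coord_notMem (show i ∉ {j | j < n} from hi), zero_coord]
  change proj {j | j < n} (X (proj {j | j < n} (e K j))) = 0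
  rw [h1, map_zero, map_zero]

end Cayley

/-! ### Extension of strongly continuous representations from dense subgroups -/

section Extension

variable {V : Type*} [NormedAddCommGroup V] [InnerProductSpace ℂ V] [CompleteSpace V]
variable {D G : Type*} [Group D] [TopologicalSpace D] [Group G] [TopologicalSpace G]
  [IsTopologicalGroup G]

/-- The orbit map is Cauchy along the trace of the neighbourhoods of `b`: `π g v` and `π h v` are as
far apart as `π (h⁻¹ g) v` and `v`, and `h⁻¹ g` tends to `1`. -/
theorem exists_tendsto_of_isDenseInducing {i : D →* G} (hi : IsDenseInducing i)
    {π : D →* (V ≃ₗᵢ[ℂ] V)} {v : V} (hπ : Filter.Tendsto (fun g => π g v) (𝓝 1) (𝓝 v)) (b : G) :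
    ∃ c, Filter.Tendsto (fun g => π g v) (Filter.comap i (𝓝 b)) (𝓝 c) := by
  have := hi.comap_nhds_neBot b
  rw [← cauchy_map_iff_exists_tendsto, cauchy_map_iff', tendsto_uniformity_iff_dist_tendsto_zero]
  have h1 : Filter.Tendsto (fun p : D × D => p.2⁻¹ * p.1)
      (Filter.comap i (𝓝 b) ×ˢ Filter.comap i (𝓝 b)) (𝓝 1) := by
    rw [hi.nhds_eq_comap, Filter.tendsto_comap_iff, map_one, ← inv_mul_cancel b]
    have h2 : Filter.Tendsto (fun p : D × D => (i p.2)⁻¹ * i p.1)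
        (Filter.comap i (𝓝 b) ×ˢ Filter.comap i (𝓝 b)) (𝓝 (b⁻¹ * b)) :=
      (Filter.tendsto_comap.comp Filter.tendsto_snd).inv.mul
        (Filter.tendsto_comap.comp Filter.tendsto_fst)
    exact h2.congr fun p => by simp
  have h3 := (hπ.comp h1).dist (tendsto_const_nhds (x := v))
  rw [dist_self] at h3
  refine h3.congr fun p => ?_
  have h4 : π p.1 v = π p.2 (π (p.2⁻¹ * p.1) v) := by
    change _ = (π p.2 * π (p.2⁻¹ * p.1)) v
    rw [← map_mul, mul_inv_cancel_left]
  change _ = dist (π p.1 v) (π p.2 v)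
  rw [h4, (π p.2).dist_map]
  rfl

/-- A strongly continuous unitary representation of a dense subgroup extends. -/
theorem exists_extension_of_isDenseInducing {i : D →* G} (hi : IsDenseInducing i)
    {π : D →* (V ≃ₗᵢ[ℂ] V)} (hπ : ∀ v, Filter.Tendsto (fun g => π g v) (𝓝 1) (𝓝 v)) :
    ∃ ρ : G →* (V ≃ₗᵢ[ℂ] V), (∀ v, Continuous fun g => ρ g v) ∧ ρ.comp i = π := by
  have hex := fun v => exists_tendsto_of_isDenseInducing hi (hπ v)
  set F : G → V → V := fun g v => hi.extend (fun d => π d v) g with hF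
  have hFc : ∀ v, Continuous fun g => F g v := fun v => hi.continuous_extend (hex v)
  have hFi : ∀ d v, F (i d) v = π d v := fun d v => hi.extend_eq' (hex v) d
  have hadd : ∀ g v w, F g (v + w) = F g v + F g w := fun g v w =>
    hi.dense.induction_on (p := fun g => F g (v + w) = F g v + F g w) g
      (isClosed_eq (hFc _) ((hFc v).add (hFc w))) fun d => by rw [hFi, hFi, hFi, map_add]
  have hsmul : ∀ g (c : ℂ) v, F g (c • v) = c • F g v := fun g c v =>
    hi.dense.induction_on (p := fun g => F g (c • v) = c • F g v) g
      (isClosed_eq (hFc _) ((hFc v).const_smul c)) fun d => by rw [hFi, hFi, map_smul]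
  have hnorm : ∀ g v, ‖F g v‖ = ‖v‖ := fun g v =>
    hi.dense.induction_on (p := fun g => ‖F g v‖ = ‖v‖) g
      (isClosed_eq (hFc v).norm continuous_const) fun d => by
        rw [hFi, LinearIsometryEquiv.norm_map]
  have hcont : ∀ g, Continuous (F g) := fun g =>
    LinearIsometry.continuous (⟨⟨⟨F g, hadd g⟩, hsmul g⟩, hnorm g⟩ : V →ₗᵢ[ℂ] V)
  have hone : ∀ v, F 1 v = v := fun v => by rw [← map_one i, hFi, map_one]; rfl
  -- Multiplicativity is extended one variable at a time, so joint continuity of `F` is not needed;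
  -- the second extension uses that each `F g` is isometric.
  have hmul₁ : ∀ g d v, F (g * i d) v = F g (F (i d) v) := fun g d v =>
    hi.dense.induction_on (p := fun g => F (g * i d) v = F g (F (i d) v)) g
      (isClosed_eq ((hFc v).comp (continuous_mul_const (i d))) (hFc _)) fun d' => by
        rw [← map_mul, hFi, hFi, hFi, map_mul]; rfl
  have hmul : ∀ g h v, F (g * h) v = F g (F h v) := fun g h v =>
    hi.dense.induction_on (p := fun h => F (g * h) v = F g (F h v)) h
      (isClosed_eq ((hFc v).comp (continuous_const_mul g)) ((hcont g).comp (hFc v)))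
      fun d => hmul₁ g d v
  let ρ : G →* (V ≃ₗᵢ[ℂ] V) :=
    { toFun := fun g =>
        { toFun := F g
          invFun := F g⁻¹
          map_add' := hadd g
          map_smul' := hsmul g
          left_inv := fun v => by rw [← hmul, inv_mul_cancel, hone]
          right_inv := fun v => by rw [← hmul, mul_inv_cancel, hone]
          norm_map' := hnorm g }
      map_one' := LinearIsometryEquiv.ext hone
      map_mul' := fun g h => LinearIsometryEquiv.ext (hmul g h) }
  exact ⟨ρ, hFc, MonoidHom.ext fun d => LinearIsometryEquiv.ext (hFi d)⟩

end Extension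

/-! ### The equivalence, and the three scalar fields -/

section Main

variable {K : Type} [NormedDivisionRing K] [NormedAlgebra ℝ K] [StarRing K] [StarNormSq K]
  [FiniteDimensional ℝ K]
variable {V : Type*} [NormedAddCommGroup V] [InnerProductSpace ℂ V] [CompleteSpace V]

variable (K) in
theorem isDenseInducing_inclusion :
    IsDenseInducing (Subgroup.inclusion (UInf0_le_UCompact0 (K := K))) where
  toIsInducing := Topology.IsInducing.of_comp (continuous_inclusion UInf0_le_UCompact0)
    continuous_subtype_val Topology.IsInducing.subtypeVal
  dense := by
    intro g
    have h := UCompact0_le_topologicalClosure g.2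
    rw [Topology.IsInducing.subtypeVal.closure_eq_preimage_closure_image, Set.mem_preimage]
    refine closure_mono ?_ h
    intro x hx
    exact ⟨⟨x, UInf0_le_UCompact0 hx⟩, ⟨⟨x, hx⟩, rfl⟩, rfl⟩

/-- Here `UInf0 K` carries its subspace topology from the operator norm, not `dirLimTopology K`;
continuity at `1` for it is exactly norm continuity. -/
theorem IsNormContinuous.extendsContinuously {π : UInf0 K →* (V ≃ₗᵢ[ℂ] V)}
    (h : IsNormContinuous π) : ExtendsContinuously π := by
  refine exists_extension_of_isDenseInducing (isDenseInducing_inclusion K) fun v => ?_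
  rw [Metric.tendsto_nhds]
  intro δ hδ
  obtain ⟨ε, hε, hεδ⟩ := h v δ hδ
  have h1 : (Subtype.val ⁻¹' {g : UFull K | ‖toOp K g - 1‖ < ε} : Set (UInf0 K)) ∈
      𝓝 (1 : UInf0 K) :=
    continuous_subtype_val.continuousAt.preimage_mem_nhds (ball_mem_nhds_one hε)
  filter_upwards [h1] with g hg
  rw [dist_eq_norm]
  exact hεδ g hg

theorem isTame_iff_extendsContinuously {π : UInf0 K →* (V ≃ₗᵢ[ℂ] V)}
    (hπ : IsContinuousRep (dirLimTopology K) π) : IsTame π ↔ ExtendsContinuously π :=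
  ⟨fun h => (h.isNormContinuous hπ).extendsContinuously,
    fun h => (isNormContinuous_of_extendsContinuously h).isTame⟩

end Main

instance : StarNormSq ℝ where
  mul_star_self a := by simp [sq]

instance : StarNormSq ℂ where
  mul_star_self a := by
    rw [← starRingEnd_apply, Complex.mul_conj']
    simp

instance : StarNormSq ℍ[ℝ] where
  mul_star_self a := by
    rw [Quaternion.self_mul_star, Quaternion.normSq_eq_norm_mul_self, ← sq]
    rfl

end TameRep

end

theorem theorem3p14 {V : Type*} [NormedAddCommGroup V] [InnerProductSpace ℂ V] [CompleteSpace V] :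
    (∀ π : TameRep.UInf0 ℝ →* (V ≃ₗᵢ[ℂ] V),
      TameRep.IsContinuousRep (TameRep.dirLimTopology ℝ) π →
        (TameRep.IsTame π ↔ TameRep.ExtendsContinuously π)) ∧
    (∀ π : TameRep.UInf0 ℂ →* (V ≃ₗᵢ[ℂ] V),
      TameRep.IsContinuousRep (TameRep.dirLimTopology ℂ) π →
        (TameRep.IsTame π ↔ TameRep.ExtendsContinuously π)) ∧
    (∀ π : TameRep.UInf0 ℍ[ℝ] →* (V ≃ₗᵢ[ℂ] V),
      TameRep.IsContinuousRep (TameRep.dirLimTopology ℍ[ℝ]) π →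
        (TameRep.IsTame π ↔ TameRep.ExtendsContinuously π)) := by
  exact ⟨fun _ h => TameRep.isTame_iff_extendsContinuously h,
    fun _ h => TameRep.isTame_iff_extendsContinuously h,
    fun _ h => TameRep.isTame_iff_extendsContinuously h⟩
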